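/- **Coifman–Fefferman inequality for Calderón–Zygmund operators with linear dependence on Wilson's constant.** Let $n\ge 1$; scalars are real or complex, and cubes $Q\subset\mathbb R^n$ have sides parallel to the axes. *Operators.* A Calderón–Zygmund operator is a bounded linear operator $T$ on $L^2(\mathbb R^n)$ for which there are a function $K(x,y)$ and constants $A$, $\varepsilon>0$ such that $$|K(x,y)|\le \frac{A}{|x-y|^{n}}\quad (x\ne y),\qquad |K(x,y)-K(z,y)|+|K(y,x)-K(y,z)|\le \frac{A\,|x-z|^{\varepsilon}}{|x-y|^{n+\varepsilon}}\quad (2|x-z|<|x-y|),$$ and, for every compactly supported $f\in L^2$, $Tf(x)=\int K(x,y)f(y)\,dy$ for a.e. $x\notin\operatorname{supp} f$. For a locally integrable $f$, $Tf$ denotes the limit, locally in measure, of $T(f\chi_{\{|y|\le k,\ |f(y)|\le k\}})$ as $k\to\infty$, whenever this limit exists; this gives the original $Tf$ for $f\in L^2$ and the usual extension of $T$ for $f\in L^s$, $1\le s<\infty$. *Maximal function and weights.* $Mf(x)=\sup_{Q\ni x}\frac1{|Q|}\int_Q|f|$. A weight is a measurable function $w:\mathbb R^n\to[0,\infty)$,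 and $w(Q)=\int_Q w$. It belongs to $A_\infty$ if for some $1<q<\infty$, with $\frac1q+\frac1{q'}=1$, $$\sup_Q\Big(\frac1{|Q|}\int_Q w\Big)\Big(\frac1{|Q|}\int_Q w^{1-q'}\Big)^{q-1}<\infty .$$ Wilson's constant is $[w]_{A_\infty}=\sup_Q \frac1{w(Q)}\int_Q M(w\chi_Q)$, and $\|h\|_{L^p(w)}=\big(\int|h|^p\,w\,dx\big)^{1/p}$. **Theorem.** Let $T$ be a Calderón–Zygmund operator on $\mathbb R^n$. There is a finite constant $c=c_{n,T}$, depending only on $n$ and $T$, such that for every $w\in A_\infty$, every $0<p<\infty$ and every locally integrable $f$ for which $Tf$ is defined and $|\{x:|Tf(x)|>t\}|<\infty$ for all $t>0$, $$\|Tf\|_{L^p(w)}\le c\,\max\{1,p\}\,[w]_{A_\infty}\,\|Mf\|_{L^p(w)} .$$ -/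

import Mathlib

open MeasureTheory Filter Topology
open scoped ENNReal NNReal

noncomputable section

namespace CZWeights

/-- Euclidean space `ℝⁿ`. -/
abbrev E (n : ℕ) : Type := EuclideanSpace ℝ (Fin n)

/-- The closed cube with sides parallel to the axes, centre `a` and side length `2 r`. -/
def cube {n : ℕ} (a : E n) (r : ℝ) : Set (E n) := {y | ∀ i, |y i - a i| ≤ r}

/-- The average of `h` over a cube. -/
def avg {n : ℕ} (a : E n) (r : ℝ) (h : E n → ℝ≥0∞) : ℝ≥0∞ :=
  (∫⁻ y in cube a r, h y) / volume (cube a r)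

/-- The (non-centred) Hardy--Littlewood maximal function of a non-negative function:
the supremum of the averages over all cubes that contain `x`. -/
def maximal {n : ℕ} (h : E n → ℝ≥0∞) (x : E n) : ℝ≥0∞ :=
  ⨆ (a : E n) (r : ℝ) (_ : 0 < r) (_ : x ∈ cube a r), avg a r h

/-- The measure `w dx`. -/
def weightMeasure {n : ℕ} (w : E n → ℝ≥0) : Measure (E n) :=
  volume.withDensity fun x => (w x : ℝ≥0∞)

/-- The Muckenhoupt constant `[w]_{A_q}`, `1 < q < ∞`; here `1 - q' = 1 - q / (q - 1)`, and a
negative power of `0` is `∞`. -/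
def ApConst {n : ℕ} (q : ℝ) (w : E n → ℝ≥0) : ℝ≥0∞ :=
  ⨆ (a : E n) (r : ℝ) (_ : 0 < r),
    avg a r (fun y => (w y : ℝ≥0∞)) *
      avg a r (fun y => (w y : ℝ≥0∞) ^ (1 - q / (q - 1))) ^ (q - 1)

/-- `w` is a weight of the class `A_∞ = ⋃_{q > 1} A_q`. -/
def IsAInfty {n : ℕ} (w : E n → ℝ≥0) : Prop :=
  AEMeasurable w ∧ ∃ q : ℝ, 1 < q ∧ ApConst q w < ∞

/-- Wilson's constant `[w]_{A_∞} = sup_Q w(Q)⁻¹ ∫_Q M(w χ_Q)`. -/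
def AInftyConst {n : ℕ} (w : E n → ℝ≥0) : ℝ≥0∞ :=
  ⨆ (a : E n) (r : ℝ) (_ : 0 < r),
    (∫⁻ x in cube a r, maximal ((cube a r).indicator fun y => (w y : ℝ≥0∞)) x) /
      weightMeasure w (cube a r)

/-- `L²(ℝⁿ)`. -/
abbrev L2 (𝕜 : Type*) [RCLike 𝕜] (n : ℕ) := Lp 𝕜 2 (volume : Measure (E n))

variable {𝕜 : Type*} [RCLike 𝕜] {n : ℕ}

/-- `K` is a standard kernel: size and Hölder regularity estimates off the diagonal. -/
def IsStandardKernel (K : E n → E n → 𝕜) : Prop :=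
  ∃ A ε : ℝ, 0 < ε ∧
    (∀ x y, x ≠ y → ‖K x y‖ ≤ A / ‖x - y‖ ^ n) ∧
    (∀ x y z, 2 * ‖x - z‖ < ‖x - y‖ →
      ‖K x y - K z y‖ + ‖K y x - K y z‖ ≤ A * ‖x - z‖ ^ ε / ‖x - y‖ ^ ((n : ℝ) + ε))

/-- A Calderón--Zygmund operator: a bounded linear operator on `L²(ℝⁿ)` which is given off the
support of its argument by a standard kernel. -/
def IsCalderonZygmund (T : L2 𝕜 n →L[𝕜] L2 𝕜 n) : Prop :=
  ∃ K : E n → E n → 𝕜, IsStandardKernel K ∧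
    ∀ (f : E n → 𝕜) (hf : MemLp f 2 volume), HasCompactSupport f →
      ∀ᵐ x, x ∉ tsupport f → T (hf.toLp f) x = ∫ y, K x y * f y

/-- The truncation `f χ_{|y| ≤ k, |f(y)| ≤ k}`. -/
def trunc (f : E n → 𝕜) (k : ℕ) : E n → 𝕜 :=
  {y | ‖y‖ ≤ k ∧ ‖f y‖ ≤ k}.indicator f

theorem memLp_trunc {f : E n → 𝕜} (hf : LocallyIntegrable f volume) (k : ℕ) :
    MemLp (trunc f k) 2 volume := by
  have hm : AEStronglyMeasurable f volume := hf.aestronglyMeasurable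
  have hs : NullMeasurableSet {y : E n | ‖y‖ ≤ k ∧ ‖f y‖ ≤ k} volume :=
    (measurableSet_le measurable_norm measurable_const).nullMeasurableSet.inter
      (nullMeasurableSet_le hm.norm.aemeasurable aemeasurable_const)
  have hg : MemLp ((Metric.closedBall (0 : E n) k).indicator fun _ => (k : ℝ)) 2 volume :=
    memLp_indicator_const 2 Metric.isClosed_closedBall.measurableSet _
      (Or.inr measure_closedBall_lt_top.ne)
  refine hg.mono (hm.indicator₀ hs) (Eventually.of_forall fun y => ?_)
  by_cases hy : ‖y‖ ≤ k ∧ ‖f y‖ ≤ k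
  · have h1 : y ∈ Metric.closedBall (0 : E n) k := by simpa using hy.1
    simp [trunc, hy, h1]
  · simp [trunc, hy]

/-- `g = T f` for a locally integrable `f`: the functions `T (trunc f k)` converge to `g` locally
in measure. For `f ∈ L²` this is the given value of `T` (`hasValue_of_memLp`), and for `f ∈ L^s`,
`1 ≤ s < ∞`, it is the usual extension of a Calderón--Zygmund operator. -/
def HasValue (T : L2 𝕜 n →L[𝕜] L2 𝕜 n) {f : E n → 𝕜} (hf : LocallyIntegrable f volume) (g : E n → 𝕜) : Prop :=
  AEStronglyMeasurable g volume ∧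
    ∀ R : ℝ, TendstoInMeasure (volume.restrict (Metric.ball (0 : E n) R))
      (fun (k : ℕ) (x : E n) => T ((memLp_trunc hf k).toLp (trunc f k)) x) atTop g

theorem hasValue_of_memLp (T : L2 𝕜 n →L[𝕜] L2 𝕜 n) {f : E n → 𝕜} (hf : LocallyIntegrable f volume)
    (h2 : MemLp f 2 volume) : HasValue T hf (T (h2.toLp f)) := by
  refine ⟨Lp.aestronglyMeasurable _, fun R => ?_⟩
  have h0 : Tendsto (fun k : ℕ => ∫⁻ x, ‖(trunc f k - f) x‖ₑ ^ (2 : ℝ)) atTop (𝓝 0) := by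
    have := tendsto_lintegral_filter_of_dominated_convergence' (μ := (volume : Measure (E n)))
      (l := atTop) (F := fun (k : ℕ) x => ‖(trunc f k - f) x‖ₑ ^ (2 : ℝ)) (f := fun _ => 0)
      (fun x => ‖f x‖ₑ ^ (2 : ℝ)) ?_ ?_ ?_ ?_
    · simpa using this
    · exact Eventually.of_forall fun k =>
        ((memLp_trunc hf k).aestronglyMeasurable.sub h2.aestronglyMeasurable).enorm.pow_const _
    · refine Eventually.of_forall fun k => Eventually.of_forall fun x => ?_
      refine ENNReal.rpow_le_rpow ?_ (by norm_num)
      by_cases hx : ‖x‖ ≤ k ∧ ‖f x‖ ≤ k <;> simp [trunc, hx]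
    · have := (eLpNorm_lt_top_iff_lintegral_rpow_enorm_lt_top (by simp) (by simp)).1 h2.2
      simpa using this.ne
    · refine Eventually.of_forall fun x => tendsto_const_nhds.congr' ?_
      filter_upwards [eventually_ge_atTop ⌈max ‖x‖ ‖f x‖⌉₊] with k hk
      have h3 : max ‖x‖ ‖f x‖ ≤ k := Nat.ceil_le.1 hk
      have h4 : ‖x‖ ≤ k ∧ ‖f x‖ ≤ k := max_le_iff.1 h3
      simp [trunc, h4]
  have h1 : Tendsto (fun k : ℕ => (memLp_trunc hf k).toLp (trunc f k)) atTop
      (𝓝 (h2.toLp f)) := by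
    rw [Lp.tendsto_Lp_iff_tendsto_eLpNorm'']
    have := h0.ennrpow_const (1 / 2 : ℝ)
    simpa [eLpNorm_eq_lintegral_rpow_enorm_toReal] using this
  have h5 : TendstoInMeasure volume
      (fun (k : ℕ) (x : E n) => T ((memLp_trunc hf k).toLp (trunc f k)) x) atTop
      (T (h2.toLp f)) :=
    tendstoInMeasure_of_tendsto_Lp ((T.continuous.tendsto _).comp h1)
  intro ε hε
  refine tendsto_of_tendsto_of_tendsto_of_le_of_le tendsto_const_nhds (h5 ε hε)
    (fun _ => zero_le) fun k => Measure.restrict_apply_le _ _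

end CZWeights

end

/-!
The estimate reduces to a pointwise domination of `T f` by a sparse sum of infima of `M f`, followed
by a Carleson embedding for the measure `w dx`.

*Local oscillation.* On every cube `Q` there is a constant `c_Q` with `|T f - c_Q| ≤ A_Q` outside a
small portion of `Q`, where `A_Q = C inf_Q M f` (`KernelData.exists_const_near`). The part of `f`
near `Q` is handled by the weak type (1,1) of `T` (`KernelData.weakType`, by the
Calderón–Zygmund decomposition), the part far from `Q` by the regularity of the kernel. Since only
measures of exceptional sets matter, the estimate passes from truncations of `f` to limits in
measure.

*Sparse domination.* In a dyadic lattice the quantities `A_Q` increase as `Q` shrinks. Below a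
stopping cube `Q`, stop at the maximal cubes `P` with `|c_P - c_Q| > A_Q + A_P`. Such a `P` lies
mostly in the exceptional set of `Q`, so the stopping cubes are sparse (`measure_stop_le`); as
`c` changes by at most `A` between a cube and its parent, `|c_P - c_{Q₀}|` is at most a multiple of
`A_P` plus the sum of `A_Q` over the stopping cubes `P ⊆ Q ⊆ Q₀` (`norm_sub_root_le`). For almost
every `x` the constants of the cubes shrinking to `x` are eventually within `A` of `T f (x)`, by
approximate continuity of `T f`, and `c_{Q₀}` is negligible for large `Q₀` because the level sets of
`T f` have finite measure.

*Weighted bound.* By sparseness, `∑ w(Q)` over the stopping cubes in `P` is at most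
`2 ∫_P M(w χ_P) ≤ 2 [w] w(P)` (`sum_measure_stop_le`), and partial summation gives
`∑ φ_Q w(Q) ≤ 2 [w] ∫ sup_{Q ∋ x} φ_Q w` for `φ` increasing along the lattice
(`sum_lintegral_stop_le`). For `p ≥ 1`, `φ_Q = A_Q S_Q ^ (p - 1)` with `S_Q` the sum of the `A_R`
over the stopping cubes `R ⊇ Q`, together with `S ^ p ≤ p ∑ A_Q S_Q ^ (p - 1)` and Hölder's
inequality, gives the factor `p [w]`. For `p ≤ 1`, `A_Q ≤ A_Q ^ p (M f) ^ (1 - p)` (up to the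
constant) and Hölder's inequality with exponents `1 / p` and `1 / (1 - p)` reduce the claim to
`φ_Q = A_Q ^ p`, with no loss as `p → 0` (`lintegral_stopSum_rpow_le`).
-/

namespace CZWeights

/-! ### Cells of a countable partition -/

section

section Cells

variable {X ι : Type*} [MeasurableSpace X] [Countable ι] [MeasurableSpace ι]
  [MeasurableSingletonClass ι] {q : X → ι}

theorem lintegral_eq_tsum_cells (hq : Measurable q) (μ : Measure X) (F : X → ℝ≥0∞) :
    ∫⁻ x, F x ∂μ = ∑' m, ∫⁻ x in q ⁻¹' {m}, F x ∂μ := by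
  have h := lintegral_iUnion (μ := μ) (s := fun m => q ⁻¹' {m})
    (fun m => hq (measurableSet_singleton m)) (fun i j hij => Set.disjoint_left.2 fun x hx hy =>
      hij (by simp_all)) F
  rw [← h, ← setLIntegral_univ]
  congr 2
  ext x; simp

theorem lintegral_le_of_cells (hq : Measurable q) {μ ν : Measure X} {F G : X → ℝ≥0∞}
    (h : ∀ m, ∫⁻ x in q ⁻¹' {m}, F x ∂μ ≤ ∫⁻ x in q ⁻¹' {m}, G x ∂ν) :
    ∫⁻ x, F x ∂μ ≤ ∫⁻ x, G x ∂ν := by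
  rw [lintegral_eq_tsum_cells hq, lintegral_eq_tsum_cells hq ν]
  exact ENNReal.tsum_le_tsum h

theorem measure_eq_tsum_cells (hq : Measurable q) (μ : Measure X) (s : Set X) :
    μ s = ∑' m, μ (s ∩ q ⁻¹' {m}) := by
  have h := lintegral_eq_tsum_cells hq (μ.restrict s) (fun _ => 1)
  simp only [lintegral_const, one_mul, Measure.restrict_apply MeasurableSet.univ,
    Set.univ_inter] at h
  rw [h]
  refine tsum_congr fun m => ?_
  rw [Measure.restrict_apply (hq (measurableSet_singleton m)), Set.inter_comm]

/-- An inequality between measures follows from the inequalities on the cells of a partition. -/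
theorem measure_le_of_cells (hq : Measurable q) {μ : Measure X} {s t : Set X} {C : ℝ≥0∞}
    (h : ∀ m, μ (s ∩ q ⁻¹' {m}) ≤ C * μ (t ∩ q ⁻¹' {m})) : μ s ≤ C * μ t := by
  rw [measure_eq_tsum_cells hq, measure_eq_tsum_cells hq μ t, ← ENNReal.tsum_mul_left]
  exact ENNReal.tsum_le_tsum h

end Cells

/-! ### Cubes and dyadic lattices -/

variable {n : ℕ}

theorem cube_eq_preimage (a : E n) (r : ℝ) :
    cube a r = WithLp.ofLp ⁻¹' (Set.univ.pi fun i => Set.Icc (a i - r) (a i + r)) := by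
  ext y
  simp only [cube, Set.mem_ofPred_eq, Set.mem_preimage, Set.mem_univ_pi, Set.mem_Icc, abs_le]
  refine forall_congr' fun i => ⟨fun h => ⟨?_, ?_⟩, fun h => ⟨?_, ?_⟩⟩ <;> linarith [h.1, h.2]

theorem isClosed_cube (a : E n) (r : ℝ) : IsClosed (cube a r) := by
  rw [cube_eq_preimage]
  exact (isClosed_set_pi fun i _ => isClosed_Icc).preimage (PiLp.continuous_ofLp 2 _)

theorem volume_cube (a : E n) (r : ℝ) :
    volume (cube a r) = ENNReal.ofReal (2 * r) ^ n := by
  rw [cube_eq_preimage, (PiLp.volume_preserving_ofLp (Fin n)).measure_preimage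
    (MeasurableSet.univ_pi fun i => measurableSet_Icc).nullMeasurableSet, Set.pi_univ_Icc,
    Real.volume_Icc_pi]
  simp only [show ∀ i, a.ofLp i + r - (a.ofLp i - r) = 2 * r from fun i => by ring,
    Finset.prod_const, Finset.card_univ, Fintype.card_fin]

theorem volume_cube_lt_top (a : E n) (r : ℝ) : volume (cube a r) < ∞ := by
  rw [volume_cube]; exact ENNReal.pow_lt_top ENNReal.ofReal_lt_top

theorem volume_cube_pos (a : E n) {r : ℝ} (hr : 0 < r) : 0 < volume (cube a r) := by
  rw [volume_cube]
  exact ENNReal.pow_pos (ENNReal.ofReal_pos.2 (by linarith)) n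

theorem volume_cube_mul (a b : E n) {s : ℝ} (hs : 0 ≤ s) (r : ℝ) :
    volume (cube a (s * r)) = ENNReal.ofReal s ^ n * volume (cube b r) := by
  rw [volume_cube, volume_cube, ← mul_pow, ← ENNReal.ofReal_mul hs]
  congr 2; ring

theorem closedBall_subset_cube (a : E n) (r : ℝ) : Metric.closedBall a r ⊆ cube a r := by
  intro y hy i
  rw [mem_closedBall_iff_norm] at hy
  exact (PiLp.norm_apply_le (y - a) i).trans hy

theorem cube_subset_closedBall (a : E n) {r : ℝ} (hr : 0 ≤ r) :
    cube a r ⊆ Metric.closedBall a (n * r) := by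
  intro y hy
  rw [mem_closedBall_iff_norm]
  refine abs_le_of_sq_le_sq' ?_ (by positivity) |>.2
  rw [EuclideanSpace.norm_sq_eq]
  have h1 : ∀ i, ‖(y - a) i‖ ^ 2 ≤ r ^ 2 := fun i => pow_le_pow_left₀ (norm_nonneg _) (hy i) 2
  have h2 := Finset.sum_le_sum fun i (_ : i ∈ Finset.univ) => h1 i
  refine h2.trans ?_
  rw [Finset.sum_const, Finset.card_univ, Fintype.card_fin, nsmul_eq_mul, mul_pow]
  gcongr
  exact_mod_cast Nat.le_self_pow two_ne_zero n

theorem cube_subset_cube_of_mem {a c : E n} {r s : ℝ} (h : a ∈ cube c s) :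
    cube c r ⊆ cube a (r + s) := fun y hy i => by
  have h1 := hy i
  have h2 := h i
  rw [abs_le] at *
  constructor <;> linarith [h1.1, h1.2, h2.1, h2.2]

/-- The indices of the half-open dyadic cube of generation `k` that contains `x`, in the lattice
with corner `a` and cubes of side `l` in generation `0`. -/
noncomputable def idx (a : E n) (l : ℝ) (k : ℕ) (x : E n) : Fin n → ℤ :=
  fun i => ⌊2 ^ k * (x i - a i) / l⌋

/-- The indices of the dyadic parent. -/
def par (m : Fin n → ℤ) : Fin n → ℤ := fun i => m i / 2

/-- The half-open dyadic cube of generation `k` with indices `m`. -/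
def dya (a : E n) (l : ℝ) (k : ℕ) (m : Fin n → ℤ) : Set (E n) := idx a l k ⁻¹' {m}

/-- The centre of a dyadic cube. -/
noncomputable def ctr (a : E n) (l : ℝ) (k : ℕ) (m : Fin n → ℤ) : E n :=
  WithLp.toLp 2 fun i => a i + l * (m i + 1 / 2) / 2 ^ k

theorem par_idx (a : E n) (l : ℝ) (k : ℕ) (x : E n) : par (idx a l (k + 1) x) = idx a l k x := by
  funext i
  have := Int.floor_div_natCast (2 ^ (k + 1) * (x i - a i) / l) 2
  simp only [par, idx]
  rw [show ((2 : ℕ) : ℤ) = 2 from rfl] at this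
  rw [← this]
  congr 1
  push_cast
  rw [pow_succ]
  ring

theorem measurable_idx (a : E n) (l : ℝ) (k : ℕ) : Measurable (idx a l k) := by
  refine measurable_pi_lambda _ fun i => Int.measurable_floor.comp ?_
  have : Measurable fun x : E n => x i := by fun_prop
  fun_prop

theorem measurableSet_dya (a : E n) (l : ℝ) (k : ℕ) (m : Fin n → ℤ) :
    MeasurableSet (dya a l k m) := measurable_idx a l k (measurableSet_singleton m)

theorem mem_dya_idx (a : E n) (l : ℝ) (k : ℕ) (x : E n) : x ∈ dya a l k (idx a l k x) := rfl

variable {a : E n} {l : ℝ} {k : ℕ} {m : Fin n → ℤ}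

theorem mem_dya (hl : 0 < l) {x : E n} : x ∈ dya a l k m ↔
    ∀ i, a i + l * m i / 2 ^ k ≤ x i ∧ x i < a i + l * (m i + 1) / 2 ^ k := by
  simp only [dya, Set.mem_preimage, Set.mem_singleton_iff, funext_iff, idx, Int.floor_eq_iff]
  refine forall_congr' fun i => and_congr ?_ ?_
  · rw [le_div_iff₀ hl, ← le_sub_iff_add_le', div_le_iff₀ (by positivity)]
    constructor <;> intro h <;> linarith
  · rw [div_lt_iff₀ hl, ← sub_lt_iff_lt_add', lt_div_iff₀ (by positivity)]
    constructor <;> intro h <;> linarith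

theorem dya_subset_cube (hl : 0 < l) :
    dya a l k m ⊆ cube (ctr a l k m) (l / 2 ^ (k + 1)) := fun x hx i => by
  have h := (mem_dya hl).1 hx i
  have e1 : l * (m i + 1) / 2 ^ k = l * (m i + 1 / 2) / 2 ^ k + l / 2 ^ (k + 1) := by
    rw [pow_succ]; field_simp; ring
  have e2 : l * m i / 2 ^ k = l * (m i + 1 / 2) / 2 ^ k - l / 2 ^ (k + 1) := by
    rw [pow_succ]; field_simp; ring
  rw [e1, e2] at h
  rw [abs_le]
  simp only [ctr]
  constructor <;> linarith [h.1, h.2]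

theorem volume_dya (hl : 0 < l) :
    volume (dya a l k m) = volume (cube (ctr a l k m) (l / 2 ^ (k + 1))) := by
  have h : dya a l k m = WithLp.ofLp ⁻¹' (Set.univ.pi fun i =>
      Set.Ico (a i + l * m i / 2 ^ k) (a i + l * (m i + 1) / 2 ^ k)) := by
    ext x; rw [mem_dya hl]; simp
  rw [h, (PiLp.volume_preserving_ofLp (Fin n)).measure_preimage
    (MeasurableSet.univ_pi fun i => measurableSet_Ico).nullMeasurableSet, Real.volume_pi_Ico,
    volume_cube, show ∀ t : ℝ≥0∞, t ^ n = ∏ _i : Fin n, t by simp]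
  refine Finset.prod_congr rfl fun i _ => ?_
  congr 1
  rw [pow_succ]; field_simp; ring

theorem dya_ae_eq_cube (hl : 0 < l) :
    dya a l k m =ᵐ[volume] cube (ctr a l k m) (l / 2 ^ (k + 1)) :=
  ae_eq_of_subset_of_measure_ge (dya_subset_cube hl) (volume_dya hl).ge
    (measurableSet_dya a l k m).nullMeasurableSet (volume_cube_lt_top _ _).ne

theorem volume_dya_lt_top (hl : 0 < l) : volume (dya a l k m) < ∞ :=
  volume_dya hl ▸ volume_cube_lt_top _ _

theorem volume_dya_pos (hl : 0 < l) : 0 < volume (dya a l k m) :=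
  volume_dya hl ▸ volume_cube_pos _ (by positivity)

theorem volume_dya_par (hl : 0 < l) (m m' : Fin n → ℤ) :
    volume (dya a l k m) = 2 ^ n * volume (dya a l (k + 1) m') := by
  rw [volume_dya hl, volume_dya hl,
    show l / 2 ^ (k + 1) = 2 * (l / 2 ^ (k + 1 + 1)) by rw [pow_succ _ (k + 1)]; field_simp,
    volume_cube_mul _ (ctr a l (k + 1) m') zero_le_two]
  simp

theorem dya_subset_par : dya a l (k + 1) m ⊆ dya a l k (par m) := fun x hx => by
  have hx : idx a l (k + 1) x = m := hx
  change idx a l k x = par m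
  rw [← hx, par_idx]

/-- The closed dyadic cubes around a point belong to a Vitali family, so that the differentiation
and density theorems hold along them. -/
theorem exists_vitaliFamily_dyadic (hn : 1 ≤ n) : ∃ v : VitaliFamily (volume : Measure (E n)),
    ∀ (a : E n) (l : ℝ), 0 < l → ∀ x, Tendsto
      (fun k => cube (ctr a l k (idx a l k x)) (l / 2 ^ (k + 1))) atTop (v.filterAt x) := by
  have hn' : (0 : ℝ) < n := by exact_mod_cast hn
  have key : ∀ (x c : E n) (ρ : ℝ), 0 < ρ → volume (Metric.closedBall x (3 * (2 * n * ρ))) ≤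
      ((6 * n : ℝ≥0) ^ n : ℝ≥0) * volume (cube c ρ) := fun x c ρ hρ => by
    refine (measure_mono (closedBall_subset_cube _ _)).trans ?_
    rw [show 3 * (2 * n * ρ) = (6 * n) * ρ by ring, volume_cube_mul x c (by positivity)]
    refine le_of_eq ?_
    congr 1
    rw [ENNReal.coe_pow]
    congr 1
    rw [ENNReal.ofReal_eq_coe_nnreal (by positivity)]
    congr 1
  have hd : ∀ x : E n, ∃ᶠ r in 𝓝[>] 0, volume (Metric.closedBall x (3 * r)) ≤
      ((6 * n : ℝ≥0) ^ n : ℝ≥0) * volume (Metric.closedBall x r) := fun x => by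
    refine Eventually.frequently ?_
    filter_upwards [self_mem_nhdsWithin] with r hr
    have hr : 0 < r := hr
    have h := key x x (r / (2 * n)) (by positivity)
    rw [show 2 * n * (r / (2 * n)) = r by field_simp] at h
    refine h.trans ?_
    gcongr
    refine (cube_subset_closedBall x (by positivity)).trans (Metric.closedBall_subset_closedBall ?_)
    rw [mul_div_assoc', div_le_iff₀ (by positivity)]
    nlinarith
  refine ⟨Vitali.vitaliFamily volume _ hd, fun a l hl x => ?_⟩
  have hρ : ∀ k : ℕ, 0 < l / 2 ^ (k + 1) := fun k => by positivity
  have hsub : ∀ k : ℕ, cube (ctr a l k (idx a l k x)) (l / 2 ^ (k + 1)) ⊆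
      Metric.closedBall x (2 * n * (l / 2 ^ (k + 1))) := fun k => by
    refine (cube_subset_cube_of_mem (dya_subset_cube hl (mem_dya_idx a l k x))).trans ?_
    refine (cube_subset_closedBall x (by linarith [hρ k])).trans
      (Metric.closedBall_subset_closedBall (by linarith))
  rw [VitaliFamily.tendsto_filterAt_iff]
  refine ⟨Eventually.of_forall fun k => ⟨isClosed_cube _ _, ?_, _, hsub k, key _ _ _ (hρ k)⟩, ?_⟩
  · refine ⟨ctr a l k (idx a l k x), mem_interior.2 ⟨Metric.ball _ (l / 2 ^ (k + 1)),
      Metric.ball_subset_closedBall.trans (closedBall_subset_cube _ _), Metric.isOpen_ball,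
      Metric.mem_ball_self (hρ k)⟩⟩
  · intro ε hε
    have h0 : Tendsto (fun k : ℕ => 2 * n * (l / 2 ^ (k + 1))) atTop (𝓝 0) := by
      have h1 := (tendsto_pow_atTop_nhds_zero_of_lt_one (r := (1 / 2 : ℝ)) (by norm_num)
        (by norm_num)).comp (tendsto_add_atTop_nat 1)
      have h2 := h1.const_mul (2 * n * l)
      rw [mul_zero] at h2
      refine h2.congr fun k => ?_
      simp only [Function.comp, one_div, inv_pow]
      field_simp
    filter_upwards [h0.eventually_le_const hε] with k hk
    exact (hsub k).trans (Metric.closedBall_subset_closedBall hk)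

end

/-! ### Standard kernels -/

section

variable {𝕜 : Type*} [RCLike 𝕜] {n : ℕ}

/-- The convolution with an integrable tail is controlled by averages over cubes of radius at
least `ρ`. -/
theorem lintegral_tail_le (n : ℕ) {ε : ℝ} (hε : 0 < ε) : ∃ C : ℝ≥0, ∀ (h : E n → ℝ≥0∞) (a : E n)
    (ρ : ℝ) (B : ℝ≥0∞), 0 < ρ → (∀ r, ρ ≤ r → avg a r h ≤ B) →
    ∫⁻ y in {y | ρ ≤ ‖y - a‖}, ENNReal.ofReal (ρ ^ ε / ‖y - a‖ ^ (n + ε)) * h y ≤ C * B := by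
  set q : ℝ≥0∞ := ENNReal.ofReal ((2 : ℝ) ^ (-ε)) with hq
  have hq1 : q < 1 := by
    rw [hq, ← ENNReal.ofReal_one]
    exact (ENNReal.ofReal_lt_ofReal_iff zero_lt_one).2
      (Real.rpow_lt_one_of_one_lt_of_neg one_lt_two (by linarith))
  have hC : (1 - q)⁻¹ * 4 ^ n ≠ ∞ := by
    refine ENNReal.mul_ne_top ?_ (by simp)
    exact ENNReal.inv_ne_top.2 (tsub_pos_iff_lt.2 hq1).ne'
  refine ⟨((1 - q)⁻¹ * 4 ^ n).toNNReal, fun h a ρ B hρ hB => ?_⟩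
  rw [ENNReal.coe_toNNReal hC]
  have hcov : {y : E n | ρ ≤ ‖y - a‖} ⊆
      ⋃ j : ℕ, {y | 2 ^ j * ρ ≤ ‖y - a‖ ∧ ‖y - a‖ < 2 ^ (j + 1) * ρ} := fun y hy => by
    have hy : ρ ≤ ‖y - a‖ := hy
    obtain ⟨j, hj1, hj2⟩ := exists_nat_pow_near (x := ‖y - a‖ / ρ) (y := (2 : ℝ))
      (by rwa [one_le_div hρ]) one_lt_two
    rw [le_div_iff₀ hρ] at hj1
    rw [div_lt_iff₀ hρ] at hj2
    exact Set.mem_iUnion.2 ⟨j, hj1, hj2⟩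
  -- the shell of radius about `2 ^ j * ρ` contributes a geometric factor
  have hshell : ∀ j : ℕ, ∫⁻ y in {y | 2 ^ j * ρ ≤ ‖y - a‖ ∧ ‖y - a‖ < 2 ^ (j + 1) * ρ},
      ENNReal.ofReal (ρ ^ ε / ‖y - a‖ ^ (n + ε)) * h y ≤ q ^ j * (4 ^ n * B) := fun j => by
    have hpos : 0 < 2 ^ j * ρ := by positivity
    have hm : MeasurableSet {y : E n | 2 ^ j * ρ ≤ ‖y - a‖ ∧ ‖y - a‖ < 2 ^ (j + 1) * ρ} :=
      (show Measurable fun y : E n => ‖y - a‖ by fun_prop) measurableSet_Ico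
    calc _ ≤ ∫⁻ y in {y | 2 ^ j * ρ ≤ ‖y - a‖ ∧ ‖y - a‖ < 2 ^ (j + 1) * ρ},
          ENNReal.ofReal (ρ ^ ε / (2 ^ j * ρ) ^ (n + ε)) * h y := by
            refine setLIntegral_mono' hm fun y hy => ?_
            gcongr
            exact hy.1
      _ = ENNReal.ofReal (ρ ^ ε / (2 ^ j * ρ) ^ (n + ε)) *
          ∫⁻ y in {y | 2 ^ j * ρ ≤ ‖y - a‖ ∧ ‖y - a‖ < 2 ^ (j + 1) * ρ}, h y :=
            lintegral_const_mul' _ _ ENNReal.ofReal_ne_top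
      _ ≤ ENNReal.ofReal (ρ ^ ε / (2 ^ j * ρ) ^ (n + ε)) *
          ∫⁻ y in cube a (2 ^ (j + 1) * ρ), h y := by
            gcongr
            refine fun y hy => closedBall_subset_cube _ _ ?_
            rw [mem_closedBall_iff_norm]
            exact hy.2.le
      _ ≤ ENNReal.ofReal (ρ ^ ε / (2 ^ j * ρ) ^ (n + ε)) *
          (B * volume (cube a (2 ^ (j + 1) * ρ))) := by
            gcongr
            refine (ENNReal.div_le_iff (volume_cube_pos a (by positivity)).ne'
              (volume_cube_lt_top a _).ne).1 (hB _ ?_)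
            exact le_mul_of_one_le_left hρ.le (one_le_pow₀ one_le_two)
      _ = q ^ j * (4 ^ n * B) := by
            rw [volume_cube, ← ENNReal.ofReal_pow (by positivity), mul_comm B, ← mul_assoc,
              ← ENNReal.ofReal_mul (by positivity), hq, ← mul_assoc,
              ← ENNReal.ofReal_pow (by positivity),
              show (4 : ℝ≥0∞) ^ n = ENNReal.ofReal (4 ^ n) by
                rw [ENNReal.ofReal_pow (by norm_num)]; norm_num,
              ← mul_assoc, ← ENNReal.ofReal_mul (by positivity)]
            congr 2
            rw [Real.rpow_add hpos, Real.rpow_natCast, Real.mul_rpow (by positivity) hρ.le,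
              Real.rpow_neg zero_le_two, inv_pow, show (2 * 2 ^ (j + 1) * ρ) ^ n =
                4 ^ n * (2 ^ j * ρ) ^ n by rw [← mul_pow]; congr 1; ring,
              show ((2 : ℝ) ^ j) ^ ε = (2 ^ ε) ^ j by
                rw [← Real.rpow_natCast, ← Real.rpow_mul zero_le_two, mul_comm,
                  Real.rpow_mul zero_le_two, Real.rpow_natCast]]
            field_simp
  calc _ ≤ _ := lintegral_mono_set hcov
    _ ≤ _ := lintegral_iUnion_le _ _
    _ ≤ ∑' j : ℕ, q ^ j * (4 ^ n * B) := ENNReal.tsum_le_tsum hshell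
    _ = _ := by rw [ENNReal.tsum_mul_right, ENNReal.tsum_geometric, mul_assoc]

/-- The data of a Calderón--Zygmund operator: its kernel `K`, and the constants `A ≥ 0` and `ε` of
the standard estimates. -/
structure KernelData (T : L2 𝕜 n →L[𝕜] L2 𝕜 n) where
  K : E n → E n → 𝕜
  A : ℝ
  ε : ℝ
  A_nonneg : 0 ≤ A
  ε_pos : 0 < ε
  size : ∀ x y, x ≠ y → ‖K x y‖ ≤ A / ‖x - y‖ ^ n
  regular : ∀ x y z, 2 * ‖x - z‖ < ‖x - y‖ →
      ‖K x y - K z y‖ + ‖K y x - K y z‖ ≤ A * ‖x - z‖ ^ ε / ‖x - y‖ ^ ((n : ℝ) + ε)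
  repr : ∀ (f : E n → 𝕜) (hf : MemLp f 2 volume), HasCompactSupport f →
      ∀ᵐ x, x ∉ tsupport f → T (hf.toLp f) x = ∫ y, K x y * f y

theorem IsCalderonZygmund.exists_kernelData {T : L2 𝕜 n →L[𝕜] L2 𝕜 n} (hT : IsCalderonZygmund T) :
    Nonempty (KernelData T) := by
  obtain ⟨K, ⟨A, ε, hε, h1, h2⟩, h3⟩ := hT
  refine ⟨⟨K, max A 0, ε, le_max_right _ _, hε, fun x y hxy => (h1 x y hxy).trans ?_,
    fun x y z h => (h2 x y z h).trans ?_, h3⟩⟩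
  · gcongr; exact le_max_left _ _
  · gcongr; exact le_max_left _ _

namespace KernelData

variable {T : L2 𝕜 n →L[𝕜] L2 𝕜 n} (D : KernelData T)

theorem continuousOn (x : E n) : ContinuousOn (D.K x) {x}ᶜ := by
  intro y hy
  have hxy : 0 < ‖y - x‖ := norm_pos_iff.2 (sub_ne_zero.2 hy)
  refine ContinuousAt.continuousWithinAt ?_
  rw [ContinuousAt, tendsto_iff_norm_sub_tendsto_zero]
  have hlim : Tendsto (fun z => D.A * ‖y - z‖ ^ D.ε / ‖y - x‖ ^ ((n : ℝ) + D.ε)) (𝓝 y) (𝓝 0) := by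
    have h1 : Continuous fun z => D.A * ‖y - z‖ ^ D.ε / ‖y - x‖ ^ ((n : ℝ) + D.ε) :=
      (continuous_const.mul ((continuous_const.sub continuous_id).norm.rpow_const
        fun _ => Or.inr D.ε_pos.le)).div_const _
    have h2 := h1.tendsto y
    simpa [Real.zero_rpow D.ε_pos.ne'] using h2
  refine squeeze_zero' (Eventually.of_forall fun _ => norm_nonneg _) ?_ hlim
  have : ∀ᶠ z in 𝓝 y, ‖z - y‖ < ‖y - x‖ / 2 := by
    filter_upwards [Metric.ball_mem_nhds y (half_pos hxy)] with z hz
    rwa [mem_ball_iff_norm] at hz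
  filter_upwards [this] with z hz
  rw [norm_sub_rev] at hz ⊢
  have := D.regular y x z (by linarith)
  linarith [norm_nonneg (D.K y x - D.K z x)]

theorem integrable_mul {x : E n} {δ : ℝ} (hδ : 0 < δ) {b : E n → 𝕜} (hb : Integrable b)
    (hs : ∀ y, b y ≠ 0 → δ ≤ ‖x - y‖) : Integrable fun y => D.K x y * b y := by
  have hF : IsClosed {y : E n | δ ≤ ‖x - y‖} :=
    isClosed_le continuous_const (continuous_const.sub continuous_id).norm
  have hsub : {y : E n | δ ≤ ‖x - y‖} ⊆ {x}ᶜ := fun y hy hyx => by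
    rw [Set.mem_singleton_iff.1 hyx] at hy
    simp at hy
    linarith
  have hm : AEStronglyMeasurable ({y : E n | δ ≤ ‖x - y‖}.indicator (D.K x)) volume :=
    (aestronglyMeasurable_indicator_iff hF.measurableSet).2
      (((D.continuousOn x).mono hsub).aestronglyMeasurable hF.measurableSet)
  have h := hb.bdd_mul (c := D.A / δ ^ n) hm (Eventually.of_forall fun y => ?_)
  · refine h.congr (Eventually.of_forall fun y => ?_)
    by_cases hy : b y = 0
    · simp [hy]
    · simp [hs y hy]
  · by_cases hy : δ ≤ ‖x - y‖
    · rw [Set.indicator_of_mem (s := {y : E n | δ ≤ ‖x - y‖}) hy]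
      refine (D.size x y fun h => hsub hy (by simp [h])).trans ?_
      have := D.A_nonneg
      gcongr
    · rw [Set.indicator_of_notMem (s := {y : E n | δ ≤ ‖x - y‖}) hy, norm_zero]
      have := D.A_nonneg
      positivity

end KernelData

end

/-! ### Estimates off the support -/

section

variable {𝕜 : Type*} [RCLike 𝕜] {n : ℕ}

theorem integrable_of_memLp_two {b : E n → 𝕜} (hb : MemLp b 2 volume) (hc : HasCompactSupport b) :
    Integrable b := by
  have h : IntegrableOn b (tsupport b) :=
    (hb.locallyIntegrable one_le_two).integrableOn_isCompact hc
  exact (integrableOn_iff_integrable_of_support_subset (subset_tsupport b)).1 h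

theorem tsupport_subset_of_isClosed {b : E n → 𝕜} {s : Set (E n)} (hs : IsClosed s)
    (h : ∀ y, b y ≠ 0 → y ∈ s) : tsupport b ⊆ s :=
  closure_minimal (fun y hy => h y hy) hs

theorem hasCompactSupport_of_closedBall {b : E n → 𝕜} {y₀ : E n} {d : ℝ}
    (h : ∀ y, b y ≠ 0 → ‖y - y₀‖ ≤ d) : HasCompactSupport b :=
  (isCompact_closedBall y₀ d).of_isClosed_subset (isClosed_tsupport b)
    (tsupport_subset_of_isClosed Metric.isClosed_closedBall fun y hy =>
      mem_closedBall_iff_norm.2 (h y hy))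

namespace KernelData

variable {T : L2 𝕜 n →L[𝕜] L2 𝕜 n}

/-- Hörmander's condition: the image of a function of mean zero is integrable away from its
support. -/
theorem lintegral_far_le (D : KernelData T) : ∃ C : ℝ≥0,
    ∀ (b : E n → 𝕜) (hb : MemLp b 2 volume) (y₀ : E n) (d : ℝ),
    0 < d → (∀ y, b y ≠ 0 → ‖y - y₀‖ ≤ d) → ∫ y, b y = 0 →
    ∫⁻ x in {x | 3 * d ≤ ‖x - y₀‖}, ‖T (hb.toLp b) x‖ₑ ≤ C * ∫⁻ y, ‖b y‖ₑ := by
  obtain ⟨C, hC⟩ := lintegral_tail_le n D.ε_pos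
  refine ⟨D.A.toNNReal * C, fun b hb y₀ d hd hs h0 => ?_⟩
  have hcs := hasCompactSupport_of_closedBall hs
  have hbi := integrable_of_memLp_two hb hcs
  have hms : MeasurableSet {x : E n | 3 * d ≤ ‖x - y₀‖} :=
    measurableSet_le measurable_const (by fun_prop)
  have hpt : ∀ᵐ x, x ∈ {x : E n | 3 * d ≤ ‖x - y₀‖} → ‖T (hb.toLp b) x‖ₑ ≤
      (ENNReal.ofReal D.A * ∫⁻ y, ‖b y‖ₑ) *
        (ENNReal.ofReal ((3 * d) ^ D.ε / ‖x - y₀‖ ^ (n + D.ε)) * 1) := by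
    filter_upwards [D.repr b hb hcs] with x hx hxd
    have hxd : 3 * d ≤ ‖x - y₀‖ := hxd
    have hxs : x ∉ tsupport b := fun h => by
      have := tsupport_subset_of_isClosed Metric.isClosed_closedBall (fun y hy =>
        mem_closedBall_iff_norm.2 (hs y hy)) h
      rw [mem_closedBall_iff_norm] at this
      linarith
    have h1 : Integrable fun y => D.K x y * b y := D.integrable_mul hd hbi fun y hy => by
      have := norm_sub_le_norm_sub_add_norm_sub x y y₀
      linarith [hs y hy]
    have h2 : ∫ y, D.K x y * b y = ∫ y, (D.K x y - D.K x y₀) * b y := by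
      simp_rw [sub_mul]
      rw [integral_sub h1 (hbi.const_mul _), integral_const_mul, h0, mul_zero, sub_zero]
    rw [hx hxs, h2]
    calc _ ≤ ∫⁻ y, ‖(D.K x y - D.K x y₀) * b y‖ₑ := enorm_integral_le_lintegral_enorm _
      _ ≤ ∫⁻ y, ENNReal.ofReal (D.A * ((3 * d) ^ D.ε / ‖x - y₀‖ ^ (n + D.ε))) * ‖b y‖ₑ := by
        refine lintegral_mono fun y => ?_
        by_cases hy : b y = 0
        · simp [hy]
        simp only [enorm_mul]
        gcongr
        rw [← ofReal_norm]
        refine ENNReal.ofReal_le_ofReal ?_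
        have hyd := hs y hy
        have h3 := D.regular y₀ x y (by rw [norm_sub_rev y₀ y, norm_sub_rev y₀ x]; linarith)
        rw [norm_sub_rev (D.K x y)]
        refine (le_add_of_nonneg_left (norm_nonneg _)).trans (h3.trans ?_)
        rw [norm_sub_rev y₀ y, norm_sub_rev y₀ x, mul_div_assoc]
        have := D.A_nonneg
        have := D.ε_pos
        gcongr
        linarith
      _ = _ := by
        rw [lintegral_const_mul' _ _ ENNReal.ofReal_ne_top, ENNReal.ofReal_mul D.A_nonneg]
        ring
  refine (setLIntegral_mono_ae' hms hpt).trans ?_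
  have hfin : ENNReal.ofReal D.A * ∫⁻ y, ‖b y‖ₑ ≠ ∞ :=
    ENNReal.mul_ne_top ENNReal.ofReal_ne_top hbi.2.ne
  rw [lintegral_const_mul' _ _ hfin]
  refine (mul_le_mul_right (hC (fun _ => 1) y₀ (3 * d) 1 (by linarith) fun r hr => ?_) _).trans ?_
  · simp only [avg, lintegral_const, one_mul, Measure.restrict_apply_univ]
    exact ENNReal.div_self_le_one
  · rw [mul_one, ENNReal.coe_mul, ENNReal.ofReal]
    exact le_of_eq (by ring)

/-- If `f` vanishes near `a`, then `T f` is almost constant near `a`, up to the averages of `|f|`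
over the large cubes with centre `a`. -/
theorem enorm_sub_le_near (D : KernelData T) : ∃ C : ℝ≥0,
    ∀ (f : E n → 𝕜) (hf : MemLp f 2 volume) (a : E n) (R : ℝ) (B : ℝ≥0∞), 0 < R →
    HasCompactSupport f → (∀ y, f y ≠ 0 → R ≤ ‖y - a‖) →
    (∀ r, R ≤ r → avg a r (fun y => ‖f y‖ₑ) ≤ B) →
    ∀ᵐ x, 2 * ‖x - a‖ < R → ‖T (hf.toLp f) x - ∫ y, D.K a y * f y‖ₑ ≤ C * B := by
  obtain ⟨C, hC⟩ := lintegral_tail_le n D.ε_pos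
  refine ⟨D.A.toNNReal * C, fun f hf a R B hR hcs hs hB => ?_⟩
  have hfi := integrable_of_memLp_two hf hcs
  have hcl : IsClosed {y : E n | R ≤ ‖y - a‖} := isClosed_le continuous_const (by fun_prop)
  filter_upwards [D.repr f hf hcs] with x hx hxa
  have hxs : x ∉ tsupport f := fun h => by
    have : R ≤ ‖x - a‖ := tsupport_subset_of_isClosed hcl hs h
    linarith [norm_nonneg (x - a)]
  have h1 : Integrable fun y => D.K x y * f y :=
    D.integrable_mul (half_pos hR) hfi fun y hy => by
      have := norm_sub_le_norm_sub_add_norm_sub y x a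
      rw [norm_sub_rev y x] at this
      linarith [hs y hy]
  have h2 : Integrable fun y => D.K a y * f y :=
    D.integrable_mul hR hfi fun y hy => by
      rw [norm_sub_rev]; exact hs y hy
  rw [hx hxs, ← integral_sub h1 h2]
  simp_rw [← sub_mul]
  calc _ ≤ ∫⁻ y, ‖(D.K x y - D.K a y) * f y‖ₑ := enorm_integral_le_lintegral_enorm _
    _ ≤ ∫⁻ y, {y | R ≤ ‖y - a‖}.indicator (fun y => ENNReal.ofReal D.A *
          (ENNReal.ofReal (R ^ D.ε / ‖y - a‖ ^ (n + D.ε)) * ‖f y‖ₑ)) y := by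
      refine lintegral_mono fun y => ?_
      by_cases hy : f y = 0
      · simp [hy]
      have hyR := hs y hy
      rw [Set.indicator_of_mem (s := {y | R ≤ ‖y - a‖}) hyR, enorm_mul, ← mul_assoc,
        ← ENNReal.ofReal_mul D.A_nonneg]
      gcongr
      rw [← ofReal_norm]
      refine ENNReal.ofReal_le_ofReal ?_
      have h3 := D.regular a y x (by rw [norm_sub_rev a x, norm_sub_rev a y]; linarith)
      rw [norm_sub_rev (D.K x y)]
      refine (le_add_of_nonneg_right (norm_nonneg _)).trans (h3.trans ?_)
      rw [norm_sub_rev a x, norm_sub_rev a y, mul_div_assoc]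
      have := D.A_nonneg
      have := D.ε_pos
      gcongr
      linarith [norm_nonneg (x - a)]
    _ = ENNReal.ofReal D.A * ∫⁻ y in {y | R ≤ ‖y - a‖},
          ENNReal.ofReal (R ^ D.ε / ‖y - a‖ ^ (n + D.ε)) * ‖f y‖ₑ := by
      rw [lintegral_indicator hcl.measurableSet, lintegral_const_mul' _ _ ENNReal.ofReal_ne_top]
    _ ≤ ENNReal.ofReal D.A * (C * B) := by
      gcongr
      exact hC _ a R B hR hB
    _ = _ := by rw [ENNReal.coe_mul, ENNReal.ofReal, mul_assoc]

end KernelData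

end

/-! ### The Calderón–Zygmund decomposition of a step function -/

section

variable {𝕜 : Type*} [RCLike 𝕜] {n : ℕ}

/-- The average of `|f|` over a dyadic cube. -/
noncomputable def dyaAvg (a : E n) (l : ℝ) (f : E n → 𝕜) (k : ℕ) (m : Fin n → ℤ) : ℝ≥0∞ :=
  (∫⁻ y in dya a l k m, ‖f y‖ₑ) / volume (dya a l k m)

/-- The average of `f` over a dyadic cube. -/
noncomputable def dyaMean (a : E n) (l : ℝ) (f : E n → 𝕜) (k : ℕ) (m : Fin n → ℤ) : 𝕜 :=
  ⨍ y in dya a l k m, f y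

/-- The dyadic cube and all its ancestors have averages at most `t`. -/
def AvgOk (a : E n) (l : ℝ) (f : E n → 𝕜) (t : ℝ≥0∞) : ℕ → (Fin n → ℤ) → Prop
  | 0, m => dyaAvg a l f 0 m ≤ t
  | k + 1, m => AvgOk a l f t k (par m) ∧ dyaAvg a l f (k + 1) m ≤ t

section

variable {a : E n} {l : ℝ} {f : E n → 𝕜} {t : ℝ≥0∞} {k : ℕ} {m : Fin n → ℤ}

theorem AvgOk.dyaAvg_le (h : AvgOk a l f t k m) : dyaAvg a l f k m ≤ t := by
  cases k with
  | zero => exact h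
  | succ k => exact h.2

theorem AvgOk.of_le {x : E n} {j : ℕ} (hjk : j ≤ k) (h : AvgOk a l f t k (idx a l k x)) :
    AvgOk a l f t j (idx a l j x) := by
  induction k, hjk using Nat.le_induction with
  | base => exact h
  | succ k _ ih => exact ih (par_idx a l k x ▸ h.1)

theorem dyaAvg_mul_volume (hl : 0 < l) :
    dyaAvg a l f k m * volume (dya a l k m) = ∫⁻ y in dya a l k m, ‖f y‖ₑ :=
  ENNReal.div_mul_cancel (volume_dya_pos hl).ne' (volume_dya_lt_top hl).ne

theorem enorm_dyaMean_le (hl : 0 < l) : ‖dyaMean a l f k m‖ₑ ≤ dyaAvg a l f k m := by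
  rw [dyaMean, setAverage_eq, enorm_smul, dyaAvg, ENNReal.div_eq_inv_mul]
  gcongr
  · rw [Measure.real, ← ENNReal.toReal_inv, Real.enorm_eq_ofReal ENNReal.toReal_nonneg,
      ENNReal.ofReal_toReal (ENNReal.inv_ne_top.2 (volume_dya_pos hl).ne')]
  · exact enorm_integral_le_lintegral_enorm _

theorem dyaAvg_succ_le (hl : 0 < l) : dyaAvg a l f (k + 1) m ≤ 2 ^ n * dyaAvg a l f k (par m) := by
  rw [dyaAvg, dyaAvg, volume_dya_par hl (par m) m, ENNReal.div_eq_inv_mul, ENNReal.div_eq_inv_mul,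
    ENNReal.mul_inv (Or.inl (by simp)) (Or.inl (by simp)), ← mul_assoc, ← mul_assoc,
    ENNReal.mul_inv_cancel (by simp) (by simp), one_mul]
  gcongr
  exact dya_subset_par

theorem integral_indicator_sub_dyaMean (hl : 0 < l) (hf : Integrable f) :
    ∫ y, ((dya a l k m).indicator f y - (dya a l k m).indicator (fun _ => dyaMean a l f k m) y) =
      0 := by
  have hD := measurableSet_dya a l k m
  have hfin := volume_dya_lt_top (a := a) (k := k) (m := m) hl
  rw [integral_sub (hf.indicator hD) ((integrable_indicator_iff hD).2 (by simp [hfin])),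
    integral_indicator hD, integral_indicator hD, setIntegral_const, dyaMean,
    measure_smul_setAverage _ hfin.ne, sub_self]

theorem lintegral_indicator_sub_dyaMean_le (hl : 0 < l) :
    ∫⁻ y, ‖(dya a l k m).indicator f y - (dya a l k m).indicator (fun _ => dyaMean a l f k m) y‖ₑ ≤
      2 * ∫⁻ y in dya a l k m, ‖f y‖ₑ := by
  have hD := measurableSet_dya a l k m
  calc _ = ∫⁻ y in dya a l k m, ‖f y - dyaMean a l f k m‖ₑ := by
        rw [← lintegral_indicator hD]
        refine lintegral_congr fun y => ?_
        by_cases hy : y ∈ dya a l k m <;> simp [hy]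
    _ ≤ ∫⁻ y in dya a l k m, (‖f y‖ₑ + ‖dyaMean a l f k m‖ₑ) :=
        lintegral_mono fun y => enorm_sub_le
    _ = (∫⁻ y in dya a l k m, ‖f y‖ₑ) + ‖dyaMean a l f k m‖ₑ * volume (dya a l k m) := by
        rw [lintegral_add_right _ measurable_const, lintegral_const, Measure.restrict_apply_univ]
    _ ≤ (∫⁻ y in dya a l k m, ‖f y‖ₑ) + dyaAvg a l f k m * volume (dya a l k m) := by
        gcongr
        exact enorm_dyaMean_le hl
    _ = _ := by rw [dyaAvg_mul_volume hl, two_mul]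

end

/-- Calderón--Zygmund decomposition at height `t` of a dyadic step function. -/
theorem exists_calderonZygmund_decomposition {a : E n} {l : ℝ} (hl : 0 < l) {f : E n → 𝕜}
    (hf : MemLp f 2 volume) (hfi : Integrable f) (hsupp : ∀ x, f x ≠ 0 → x ∈ dya a l 0 0) {N : ℕ}
    (hstep : ∀ x y, idx a l N x = idx a l N y → f x = f y) {t : ℝ≥0∞} (ht0 : 0 < t)
    (ht : t ≠ ∞) (htop : ∫⁻ x, ‖f x‖ₑ ≤ t * volume (dya a l 0 0)) :
    ∃ (S : Finset (ℕ × (Fin n → ℤ))) (b : ℕ × (Fin n → ℤ) → E n → 𝕜),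
      (∀ s, MemLp (b s) 2 volume) ∧ (∀ s y, b s y ≠ 0 → y ∈ dya a l s.1 s.2) ∧
      (∀ s, ∫ y, b s y = 0) ∧ (∀ s, ∫⁻ y, ‖b s y‖ₑ ≤ 2 * ∫⁻ y in dya a l s.1 s.2, ‖f y‖ₑ) ∧
      (∀ s ∈ S, volume (dya a l s.1 s.2) ≤ (∫⁻ y in dya a l s.1 s.2, ‖f y‖ₑ) / t) ∧
      (S : Set (ℕ × (Fin n → ℤ))).PairwiseDisjoint (fun s => dya a l s.1 s.2) ∧
      (∀ x, ‖f x - ∑ s ∈ S, b s x‖ₑ ≤ 2 ^ n * t) ∧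
      ∫⁻ x, ‖f x - ∑ s ∈ S, b s x‖ₑ ≤ ∫⁻ x, ‖f x‖ₑ := by
  classical
  -- `P k m`: the cube of generation `k + 1` is a maximal one with average above `t`
  let P : ℕ → (Fin n → ℤ) → Prop := fun k m =>
    AvgOk a l f t k (par m) ∧ t < dyaAvg a l f (k + 1) m
  let S : Finset (ℕ × (Fin n → ℤ)) :=
    ((Finset.range N ×ˢ Fintype.piFinset fun _ => Finset.Ico (0 : ℤ) (2 ^ N)).filter
      fun s => P s.1 s.2).map
        ⟨fun s => (s.1 + 1, s.2), fun s s' h => by simpa [Prod.ext_iff] using h⟩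
  let b : ℕ × (Fin n → ℤ) → E n → 𝕜 := fun s y => (dya a l s.1 s.2).indicator f y -
    (dya a l s.1 s.2).indicator (fun _ => dyaMean a l f s.1 s.2) y
  have hbout : ∀ s y, y ∉ dya a l s.1 s.2 → b s y = 0 := fun s y hy => by simp [b, hy]
  have hbin : ∀ s y, y ∈ dya a l s.1 s.2 → b s y = f y - dyaMean a l f s.1 s.2 :=
    fun s y hy => by simp [b, hy]
  have hSmem : ∀ k m, (k, m) ∈ S → ∃ j, j < N ∧ P j m ∧ k = j + 1 := fun k m h => by
    obtain ⟨⟨j, m'⟩, hs, hs'⟩ := Finset.mem_map.1 h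
    simp only [Finset.mem_filter, Finset.mem_product, Finset.mem_range] at hs
    have h1 : j + 1 = k := congrArg Prod.fst hs'
    have h2 : m' = m := congrArg Prod.snd hs'
    exact ⟨j, hs.1.1, h2 ▸ hs.2, h1.symm⟩
  have hmemS : ∀ j x, j < N → P j (idx a l (j + 1) x) → (j + 1, idx a l (j + 1) x) ∈ S := by
    intro j x hj hP
    refine Finset.mem_map.2 ⟨(j, idx a l (j + 1) x), ?_, rfl⟩
    simp only [Finset.mem_filter, Finset.mem_product, Finset.mem_range, Fintype.mem_piFinset,
      Finset.mem_Ico]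
    refine ⟨⟨hj, fun i => ?_⟩, hP⟩
    obtain ⟨y, hy, hfy⟩ : ∃ y ∈ dya a l (j + 1) (idx a l (j + 1) x), f y ≠ 0 := by
      by_contra! hcon
      have : dyaAvg a l f (j + 1) (idx a l (j + 1) x) = 0 := by
        rw [dyaAvg, setLIntegral_congr_fun (g := fun _ => 0) (measurableSet_dya _ _ _ _)
          fun y hy => by simp [hcon y hy]]
        simp
      exact (lt_of_le_of_lt zero_le hP.2).ne' this
    rw [← show idx a l (j + 1) y = _ from hy]
    have h0 := (mem_dya hl).1 (hsupp y hfy) i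
    simp only [Pi.zero_apply, Int.cast_zero, mul_zero, pow_zero, add_zero, zero_add,
      mul_one, div_one] at h0
    have hpow : (2 : ℝ) ^ (j + 1) ≤ 2 ^ N := pow_le_pow_right₀ one_le_two hj
    simp only [idx]
    constructor
    · refine Int.floor_nonneg.2 (div_nonneg (mul_nonneg (by positivity) ?_) hl.le)
      linarith [h0.1]
    · rw [Int.floor_lt]
      push_cast
      rw [div_lt_iff₀ hl]
      have h1 : y i - a i < l := by linarith [h0.2]
      exact mul_lt_mul_of_le_of_lt_of_pos_of_nonneg hpow h1 (by positivity) hl.le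
  have huniq : ∀ j j' x, P j (idx a l (j + 1) x) → P j' (idx a l (j' + 1) x) → j ≤ j' := by
    intro j j' x h h'
    by_contra! hlt
    have h1 := h.1
    rw [par_idx] at h1
    exact (h1.of_le (j := j' + 1) hlt).dyaAvg_le.not_gt h'.2
  have hdisj : (S : Set (ℕ × (Fin n → ℤ))).PairwiseDisjoint fun s => dya a l s.1 s.2 := by
    rintro ⟨k, m⟩ hs ⟨k', m'⟩ hs' hne
    refine Set.disjoint_left.2 fun x hx hx' => hne ?_
    obtain ⟨j, _, hP, rfl⟩ := hSmem _ _ hs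
    obtain ⟨j', _, hP', rfl⟩ := hSmem _ _ hs'
    have e : idx a l (j + 1) x = m := hx
    have e' : idx a l (j' + 1) x = m' := hx'
    subst e e'
    have := le_antisymm (huniq _ _ x hP hP') (huniq _ _ x hP' hP)
    subst this
    rfl
  -- on a selected cube the good part is the mean of `f`
  have hgood_in : ∀ s ∈ S, ∀ x ∈ dya a l s.1 s.2,
      f x - ∑ s ∈ S, b s x = dyaMean a l f s.1 s.2 := fun s hs x hx => by
    rw [Finset.sum_eq_single_of_mem s hs fun s' hs' hne => hbout s' x fun hx' =>
      (Set.disjoint_left.1 (hdisj hs' hs hne) hx' hx).elim, hbin s x hx]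
    ring
  have hgood_out : ∀ x, (∀ s ∈ S, x ∉ dya a l s.1 s.2) → f x - ∑ s ∈ S, b s x = f x := fun x hx => by
    rw [Finset.sum_eq_zero fun s hs => hbout s x (hx s hs), sub_zero]
  have hok0 : ∀ m, AvgOk a l f t 0 m := fun m => by
    change dyaAvg a l f 0 m ≤ t
    by_cases hm : m = 0
    · subst hm
      exact ENNReal.div_le_of_le_mul ((setLIntegral_le_lintegral _ _).trans htop)
    · rw [dyaAvg, setLIntegral_congr_fun (g := fun _ => 0) (measurableSet_dya _ _ _ _)
          fun y hy => ?_]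
      · simp
      · have : f y = 0 := by
          by_contra hfy
          exact hm ((show idx a l 0 y = m from hy).symm.trans (hsupp y hfy))
        simp [this]
  refine ⟨S, b, fun s => ?_, fun s y hy => by_contra fun h => hy (hbout s y h),
    fun s => integral_indicator_sub_dyaMean hl hfi,
    fun s => lintegral_indicator_sub_dyaMean_le hl, ?_, hdisj, fun x => ?_, ?_⟩
  · exact (hf.indicator (measurableSet_dya _ _ _ _)).sub (memLp_indicator_const 2
      (measurableSet_dya _ _ _ _) _ (Or.inr (volume_dya_lt_top hl).ne))
  · rintro ⟨k, m⟩ hs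
    obtain ⟨j, _, hP, rfl⟩ := hSmem _ _ hs
    rw [ENNReal.le_div_iff_mul_le (Or.inl ht0.ne') (Or.inl ht), ← dyaAvg_mul_volume hl, mul_comm]
    gcongr
    exact hP.2.le
  · by_cases hx : ∃ s ∈ S, x ∈ dya a l s.1 s.2
    · obtain ⟨⟨k, m⟩, hs, hxs⟩ := hx
      rw [hgood_in _ hs x hxs]
      obtain ⟨j, _, hP, rfl⟩ := hSmem _ _ hs
      refine (enorm_dyaMean_le hl).trans ((dyaAvg_succ_le hl).trans ?_)
      gcongr
      exact hP.1.dyaAvg_le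
    · push Not at hx
      rw [hgood_out x hx]
      have hok : ∀ k ≤ N, AvgOk a l f t k (idx a l k x) := fun k => by
        induction k with
        | zero => exact fun _ => hok0 _
        | succ k ih =>
          intro hk
          refine ⟨by rw [par_idx]; exact ih (by omega), ?_⟩
          by_contra! hlt
          exact hx _ (hmemS k x hk ⟨by rw [par_idx]; exact ih (by omega), hlt⟩) rfl
      have h1 := (hok N le_rfl).dyaAvg_le
      rw [dyaAvg, setLIntegral_congr_fun (g := fun _ => ‖f x‖ₑ) (measurableSet_dya _ _ _ _)
        fun y hy => by rw [hstep y x hy], setLIntegral_const, ENNReal.mul_div_cancel_right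
          (volume_dya_pos hl).ne' (volume_dya_lt_top hl).ne] at h1
      exact h1.trans (le_mul_of_one_le_left zero_le (one_le_pow₀ one_le_two))
  · set U := ⋃ s ∈ S, dya a l s.1 s.2 with hU
    have hUm : MeasurableSet U := Finset.measurableSet_biUnion _ fun s _ => measurableSet_dya _ _ _ _
    rw [← lintegral_add_compl _ hUm, ← lintegral_add_compl (fun x => ‖f x‖ₑ) hUm]
    refine add_le_add ?_ ?_
    · rw [hU, lintegral_biUnion_finset hdisj fun s _ => measurableSet_dya _ _ _ _,
        lintegral_biUnion_finset hdisj fun s _ => measurableSet_dya _ _ _ _]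
      refine Finset.sum_le_sum fun s hs => ?_
      rw [setLIntegral_congr_fun (g := fun _ => ‖dyaMean a l f s.1 s.2‖ₑ)
        (measurableSet_dya _ _ _ _) fun x hx => by simp only [hgood_in s hs x hx],
        setLIntegral_const, ← dyaAvg_mul_volume hl]
      gcongr
      exact enorm_dyaMean_le hl
    · refine le_of_eq (setLIntegral_congr_fun hUm.compl fun x hx => ?_)
      rw [hgood_out x fun s hs hxs => hx (Set.mem_biUnion hs hxs)]

theorem measure_le_enorm_apply_le (T : L2 𝕜 n →L[𝕜] L2 𝕜 n) {h : E n → 𝕜} (hh : MemLp h 2 volume)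
    {s : ℝ≥0∞} (hs : s ≠ 0) (hs' : s ≠ ∞) :
    volume {x | s ≤ ‖T (hh.toLp h) x‖ₑ} ≤ ‖T‖ₑ ^ 2 * (∫⁻ x, ‖h x‖ₑ ^ 2) / s ^ 2 := by
  refine (meas_ge_le_mul_pow_eLpNorm_enorm volume two_ne_zero (by simp)
    (Lp.aestronglyMeasurable _) hs (by simp [hs'])).trans ?_
  have h1 : eLpNorm (T (hh.toLp h)) 2 volume ≤ ‖T‖ₑ * eLpNorm h 2 volume := by
    rw [← Lp.enorm_def, ← Lp.enorm_toLp hh]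
    exact T.le_opENorm _
  have h2 : eLpNorm h 2 volume ^ 2 = ∫⁻ x, ‖h x‖ₑ ^ 2 := by
    have := eLpNorm_nnreal_pow_eq_lintegral (f := h) (μ := volume) (p := 2) two_ne_zero
    simpa using this
  rw [← h2, ← mul_pow, ENNReal.div_eq_inv_mul]
  simp only [ENNReal.toReal_ofNat, ENNReal.rpow_ofNat]
  rw [ENNReal.inv_pow]
  gcongr

end

/-! ### The weak type (1,1) estimate -/

section

variable {𝕜 : Type*} [RCLike 𝕜] {n : ℕ}

namespace KernelData

variable {T : L2 𝕜 n →L[𝕜] L2 𝕜 n}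

/-- The weak type (1,1) estimate on dyadic step functions. -/
theorem weakType_step (D : KernelData T) (hn : 1 ≤ n) : ∃ C : ℝ≥0, ∀ (a : E n) (l : ℝ), 0 < l →
    ∀ (f : E n → 𝕜) (hf : MemLp f 2 volume), Integrable f → (∀ x, f x ≠ 0 → x ∈ dya a l 0 0) →
    ∀ N, (∀ x y, idx a l N x = idx a l N y → f x = f y) → ∀ t : ℝ≥0∞, 0 < t → t ≠ ∞ →
    ∫⁻ x, ‖f x‖ₑ ≤ t * volume (dya a l 0 0) →
    volume {x | t < ‖T (hf.toLp f) x‖ₑ} ≤ C * (∫⁻ x, ‖f x‖ₑ) / t := by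
  obtain ⟨C₁, hC₁⟩ := D.lintegral_far_le
  refine ⟨‖T‖₊ ^ 2 * 2 ^ n * 4 + (3 * n) ^ n + 4 * C₁,
    fun a l hl f hf hfi hsupp N hstep t ht0 ht htop => ?_⟩
  obtain ⟨S, b, hb2, hbs, hb0, hb1, hSv, hdisj, hh, hh1⟩ :=
    exists_calderonZygmund_decomposition hl hf hfi hsupp hstep ht0 ht htop
  set I := ∫⁻ x, ‖f x‖ₑ with hI
  have hn' : (0 : ℝ) < n := by exact_mod_cast hn
  have hsum : ∑ s ∈ S, ∫⁻ y in dya a l s.1 s.2, ‖f y‖ₑ ≤ I := by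
    rw [← lintegral_biUnion_finset hdisj fun s _ => measurableSet_dya _ _ _ _]
    exact setLIntegral_le_lintegral _ _
  have hh2 : MemLp (fun x => f x - ∑ s ∈ S, b s x) 2 volume :=
    hf.sub (memLp_finsetSum S fun s _ => hb2 s)
  -- `d s` bounds the distance of the points of the cube `s` from its centre
  let d : ℕ × (Fin n → ℤ) → ℝ := fun s => n * (l / 2 ^ (s.1 + 1))
  have hd : ∀ s, 0 < d s := fun s => by positivity
  have hbd : ∀ s y, b s y ≠ 0 → ‖y - ctr a l s.1 s.2‖ ≤ d s := fun s y hy =>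
    mem_closedBall_iff_norm.1 (cube_subset_closedBall _ (by positivity)
      (dya_subset_cube hl (hbs s y hy)))
  let far : ℕ × (Fin n → ℤ) → Set (E n) := fun s => {x | 3 * d s ≤ ‖x - ctr a l s.1 s.2‖}
  have hfarm : ∀ s, MeasurableSet (far s) := fun s =>
    measurableSet_le measurable_const (by fun_prop)
  set G : Set (E n) := ⋂ s ∈ S, far s with hG
  have hGm : MeasurableSet G := Finset.measurableSet_biInter _ fun s _ => hfarm s
  let F : E n → ℝ≥0∞ := fun x => ∑ s ∈ S, ‖T ((hb2 s).toLp (b s)) x‖ₑ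
  have hae : ∀ᵐ x, ‖T (hf.toLp f) x‖ₑ ≤ ‖T (hh2.toLp _) x‖ₑ + F x := by
    have e1 : hf.toLp f = hh2.toLp _ + ∑ s ∈ S, (hb2 s).toLp (b s) := by
      ext1
      filter_upwards [hf.coeFn_toLp, Lp.coeFn_add (hh2.toLp _) (∑ s ∈ S, (hb2 s).toLp (b s)),
        hh2.coeFn_toLp, Lp.coeFn_fun_finsetSum S fun s => (hb2 s).toLp (b s),
        (Finset.eventually_all S).2 fun s _ => (hb2 s).coeFn_toLp] with x h1 h2 h3 h4 h5
      rw [h1, h2, Pi.add_apply, h3, h4, Finset.sum_congr rfl fun s hs => h5 s hs]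
      ring
    have e2 : T (hf.toLp f) = T (hh2.toLp _) + ∑ s ∈ S, T ((hb2 s).toLp (b s)) := by
      rw [e1, map_add, map_sum]
    rw [e2]
    filter_upwards [Lp.coeFn_add (T (hh2.toLp _)) (∑ s ∈ S, T ((hb2 s).toLp (b s))),
      Lp.coeFn_fun_finsetSum S fun s => T ((hb2 s).toLp (b s))] with x h2 h4
    rw [h2, Pi.add_apply, h4]
    exact (enorm_add_le _ _).trans (by gcongr; exact enorm_sum_le _ _)
  have ht2 : t / 2 ≠ 0 := (ENNReal.half_pos ht0.ne').ne'
  have ht2' : t / 2 ≠ ∞ := (ENNReal.div_lt_top ht two_ne_zero).ne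
  have hFm : AEMeasurable F (volume.restrict G) :=
    (Finset.aemeasurable_fun_sum _ fun s _ =>
      (Lp.aestronglyMeasurable _).enorm).restrict
  have hcov : {x | t < ‖T (hf.toLp f) x‖ₑ} ≤ᵐ[volume]
      (({x | t / 2 ≤ ‖T (hh2.toLp _) x‖ₑ} ∪ ⋃ s ∈ S, (far s)ᶜ) ∪ ({x | t / 2 ≤ F x} ∩ G) :
        Set (E n)) := by
    filter_upwards [hae] with x hx hxt
    have hxt : t < ‖T (hf.toLp f) x‖ₑ := hxt
    by_cases h1 : t / 2 ≤ ‖T (hh2.toLp _) x‖ₑ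
    · exact Or.inl (Or.inl h1)
    by_cases h2 : x ∈ G
    · refine Or.inr ⟨?_, h2⟩
      by_contra h3
      have h3 : F x < t / 2 := not_le.1 h3
      have := (hxt.trans_le hx).trans (ENNReal.add_lt_add (not_le.1 h1) h3)
      rw [ENNReal.add_halves] at this
      exact this.false
    · refine Or.inl (Or.inr ?_)
      simp only [hG, Set.mem_iInter, not_forall] at h2
      obtain ⟨s, hs, hx⟩ := h2
      exact Set.mem_biUnion hs hx
  have b1 : volume {x | t / 2 ≤ ‖T (hh2.toLp _) x‖ₑ} ≤ (‖T‖₊ ^ 2 * 2 ^ n * 4 : ℝ≥0) * I / t := by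
    refine (measure_le_enorm_apply_le T hh2 ht2 ht2').trans ?_
    have : ∫⁻ x, ‖f x - ∑ s ∈ S, b s x‖ₑ ^ 2 ≤ 2 ^ n * t * I := by
      calc _ ≤ ∫⁻ x, 2 ^ n * t * ‖f x - ∑ s ∈ S, b s x‖ₑ := lintegral_mono fun x => by
            rw [sq]; gcongr; exact hh x
        _ = 2 ^ n * t * ∫⁻ x, ‖f x - ∑ s ∈ S, b s x‖ₑ :=
            lintegral_const_mul' _ _ (ENNReal.mul_ne_top (by simp) ht)
        _ ≤ _ := by gcongr
    calc _ ≤ ‖T‖ₑ ^ 2 * (2 ^ n * t * I) / (t / 2) ^ 2 := by gcongr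
      _ = (‖T‖ₑ ^ 2 * 2 ^ n * I) * (t / (t / 2) ^ 2) := by
        simp only [ENNReal.div_eq_inv_mul]; ring
      _ = (‖T‖ₑ ^ 2 * 2 ^ n * I) * (4 * t⁻¹) := by
        congr 1
        rw [ENNReal.div_eq_inv_mul, ENNReal.div_eq_inv_mul, mul_pow, sq t,
          ENNReal.mul_inv (by simp) (by simp), ENNReal.mul_inv (by simp [ht]) (by simp [ht]),
          mul_assoc, mul_assoc, ENNReal.inv_mul_cancel ht0.ne' ht, mul_one, ENNReal.inv_pow,
          inv_inv]
        norm_num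
      _ = _ := by
        rw [ENNReal.div_eq_inv_mul, enorm_eq_nnnorm]
        push_cast
        ring
  have b2 : volume (⋃ s ∈ S, (far s)ᶜ) ≤ ((3 * n) ^ n : ℝ≥0) * I / t := by
    refine (measure_biUnion_finset_le _ _).trans ?_
    calc _ ≤ ∑ s ∈ S, ((3 * n : ℝ≥0) ^ n : ℝ≥0) * ((∫⁻ y in dya a l s.1 s.2, ‖f y‖ₑ) / t) := by
          refine Finset.sum_le_sum fun s hs => ?_
          have hsub : (far s)ᶜ ⊆ cube (ctr a l s.1 s.2) ((3 * n) * (l / 2 ^ (s.1 + 1))) :=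
            fun x hx => closedBall_subset_cube _ _ (mem_closedBall_iff_norm.2 (by
              have hx : ¬ 3 * d s ≤ ‖x - ctr a l s.1 s.2‖ := hx
              rw [mul_assoc]
              exact (not_le.1 hx).le))
          refine (measure_mono hsub).trans ?_
          rw [volume_cube_mul _ (ctr a l s.1 s.2) (by positivity), ← volume_dya hl]
          refine mul_le_mul' (le_of_eq ?_) (hSv s hs)
          rw [ENNReal.coe_pow]
          congr 1
          rw [ENNReal.ofReal_eq_coe_nnreal (by positivity)]
          congr 1
      _ = ((3 * n : ℝ≥0) ^ n : ℝ≥0) * ((∑ s ∈ S, ∫⁻ y in dya a l s.1 s.2, ‖f y‖ₑ) / t) := by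
          rw [← Finset.mul_sum]
          simp only [ENNReal.div_eq_inv_mul, Finset.mul_sum]
      _ ≤ _ := by
          rw [mul_div_assoc]
          gcongr
  have b3 : volume ({x | t / 2 ≤ F x} ∩ G) ≤ (4 * C₁ : ℝ≥0) * I / t := by
    rw [← Measure.restrict_apply' hGm]
    refine (meas_ge_le_lintegral_div hFm ht2 ht2').trans ?_
    have : ∫⁻ x in G, F x ≤ 2 * C₁ * I := by
      calc ∫⁻ x in G, F x = ∑ s ∈ S, ∫⁻ x in G, ‖T ((hb2 s).toLp (b s)) x‖ₑ :=
            lintegral_finsetSum' _ fun s _ => (Lp.aestronglyMeasurable _).enorm.restrict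
        _ ≤ ∑ s ∈ S, C₁ * (2 * ∫⁻ y in dya a l s.1 s.2, ‖f y‖ₑ) := by
            refine Finset.sum_le_sum fun s hs => ?_
            refine (lintegral_mono_set (Set.biInter_subset_of_mem hs)).trans ?_
            refine (hC₁ (b s) (hb2 s) _ (d s) (hd s) (hbd s) (hb0 s)).trans ?_
            gcongr
            exact hb1 s
        _ = 2 * C₁ * ∑ s ∈ S, ∫⁻ y in dya a l s.1 s.2, ‖f y‖ₑ := by
            rw [Finset.mul_sum]; exact Finset.sum_congr rfl fun s _ => by ring
        _ ≤ _ := by gcongr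
    calc _ ≤ 2 * C₁ * I / (t / 2) := by gcongr
      _ = _ := by
        rw [ENNReal.div_eq_inv_mul, ENNReal.div_eq_inv_mul, ENNReal.div_eq_inv_mul,
          ENNReal.mul_inv (by simp) (by simp), inv_inv]
        push_cast
        ring
  calc _ ≤ _ := measure_mono_ae hcov
    _ ≤ _ := (measure_union_le _ _).trans (add_le_add (measure_union_le _ _) le_rfl)
    _ ≤ _ := add_le_add (add_le_add b1 b2) b3
    _ = _ := by
      simp only [ENNReal.div_eq_inv_mul]
      push_cast
      ring

end KernelData

end

section

variable {𝕜 : Type*} [RCLike 𝕜] {n : ℕ}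

theorem idx_eq_of_le {a : E n} {l : ℝ} {j k : ℕ} (hjk : j ≤ k) {x y : E n}
    (h : idx a l k x = idx a l k y) : idx a l j x = idx a l j y := by
  induction k, hjk using Nat.le_induction with
  | base => exact h
  | succ k _ ih => exact ih (by rw [← par_idx a l k x, h, par_idx])

/-- The cube `[-L, L)ⁿ` as the cube of generation `0` with index `0` of a dyadic lattice. -/
theorem mem_dya_zero {L : ℝ} (hL : 0 < L) {x : E n} :
    x ∈ dya (WithLp.toLp 2 fun _ => -L : E n) (2 * L) 0 0 ↔ ∀ i, -L ≤ x i ∧ x i < L := by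
  rw [mem_dya (by positivity)]
  simp only [Pi.zero_apply, Int.cast_zero, mul_zero, pow_zero, div_one, add_zero, zero_add, mul_one]
  refine forall_congr' fun i => and_congr Iff.rfl ?_
  rw [show -L + 2 * L = L by ring]

theorem volume_dya_zero {L : ℝ} (hL : 0 < L) :
    volume (dya (WithLp.toLp 2 fun _ => -L : E n) (2 * L) 0 0) = ENNReal.ofReal (2 * L) ^ n := by
  rw [volume_dya (by positivity), volume_cube]
  congr 2
  ring

theorem tendsto_dyaMean (hn : 1 ≤ n) {a : E n} {l : ℝ} (hl : 0 < l) {f : E n → 𝕜}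
    (hf : LocallyIntegrable f volume) :
    ∀ᵐ x, Tendsto (fun N => dyaMean a l f N (idx a l N x)) atTop (𝓝 (f x)) := by
  obtain ⟨v, hv⟩ := exists_vitaliFamily_dyadic hn
  filter_upwards [v.ae_tendsto_average hf] with x hx
  refine (hx.comp (hv a l hl x)).congr fun N => ?_
  exact (setAverage_congr (dya_ae_eq_cube hl)).symm

theorem lintegral_dyaMean_le {a : E n} {l : ℝ} (hl : 0 < l) (f : E n → 𝕜) (N : ℕ) :
    ∫⁻ x, ‖dyaMean a l f N (idx a l N x)‖ₑ ≤ ∫⁻ x, ‖f x‖ₑ := by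
  refine lintegral_le_of_cells (measurable_idx a l N) fun m => ?_
  change ∫⁻ x in dya a l N m, _ ≤ ∫⁻ x in dya a l N m, _
  rw [setLIntegral_congr_fun (g := fun _ => ‖dyaMean a l f N m‖ₑ) (measurableSet_dya _ _ _ _)
    fun x hx => by rw [show idx a l N x = m from hx], setLIntegral_const, ← dyaAvg_mul_volume hl]
  gcongr
  exact enorm_dyaMean_le hl

theorem enorm_dyaMean_le_of_bounded {a : E n} {l : ℝ} (hl : 0 < l) {f : E n → 𝕜} {M : ℝ≥0}
    (hM : ∀ x, ‖f x‖ₑ ≤ M) (k : ℕ) (m : Fin n → ℤ) : ‖dyaMean a l f k m‖ₑ ≤ M := by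
  refine (enorm_dyaMean_le hl).trans (ENNReal.div_le_of_le_mul ?_)
  rw [← setLIntegral_const]
  exact lintegral_mono hM

namespace KernelData

variable {T : L2 𝕜 n →L[𝕜] L2 𝕜 n}

/-- Calderón--Zygmund operators are of weak type (1,1). -/
theorem weakType (D : KernelData T) (hn : 1 ≤ n) : ∃ C : ℝ≥0, ∀ (f : E n → 𝕜)
    (hf : MemLp f 2 volume) (M : ℝ≥0), (∀ x, ‖f x‖ₑ ≤ M) → ∀ R : ℝ, (∀ x, f x ≠ 0 → ‖x‖ ≤ R) →
    ∀ t : ℝ≥0∞, 0 < t → t ≠ ∞ →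
    volume {x | t < ‖T (hf.toLp f) x‖ₑ} ≤ C * (∫⁻ x, ‖f x‖ₑ) / t := by
  obtain ⟨C, hC⟩ := D.weakType_step hn
  refine ⟨2 * C, fun f hf M hM R hR t ht0 ht => ?_⟩
  have hfi : Integrable f := integrable_of_memLp_two hf
    (hasCompactSupport_of_closedBall (y₀ := 0) (d := R) (by simpa using hR))
  have ht2 : 0 < t / 2 := ENNReal.half_pos ht0.ne'
  have ht2' : t / 2 ≠ ∞ := (ENNReal.div_lt_top ht two_ne_zero).ne
  -- a cube that contains the support and on which the average of `|f|` is at most `t / 2`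
  set L : ℝ := |R| + 1 + ((∫⁻ x, ‖f x‖ₑ) / (t / 2)).toReal with hLdef
  have hL1 : 1 ≤ L := by
    have : 0 ≤ ((∫⁻ x, ‖f x‖ₑ) / (t / 2)).toReal := ENNReal.toReal_nonneg
    linarith [abs_nonneg R]
  have hLR : R < L := by
    have : 0 ≤ ((∫⁻ x, ‖f x‖ₑ) / (t / 2)).toReal := ENNReal.toReal_nonneg
    linarith [le_abs_self R]
  have hL0 : 0 < L := by linarith
  set a : E n := WithLp.toLp 2 fun _ => -L with ha
  set l : ℝ := 2 * L with hldef
  have hl : 0 < l := by positivity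
  have hsupp : ∀ x, f x ≠ 0 → x ∈ dya a l 0 0 := fun x hx => by
    refine (mem_dya_zero hL0).2 fun i => ?_
    have h1 := (PiLp.norm_apply_le x i).trans (hR x hx)
    rw [Real.norm_eq_abs, abs_le] at h1
    constructor <;> linarith [h1.1, h1.2]
  have htop : ∫⁻ x, ‖f x‖ₑ ≤ t / 2 * volume (dya a l 0 0) := by
    rw [volume_dya_zero hL0, mul_comm, ← ENNReal.div_le_iff ht2.ne' ht2']
    have h1 : (∫⁻ x, ‖f x‖ₑ) / (t / 2) ≤ ENNReal.ofReal (2 * L) := by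
      rw [← ENNReal.ofReal_toReal (ENNReal.div_lt_top hfi.2.ne ht2.ne').ne]
      refine ENNReal.ofReal_le_ofReal ?_
      linarith [abs_nonneg R]
    refine h1.trans (le_self_pow₀ ?_ (by omega))
    rw [← ENNReal.ofReal_one]
    exact ENNReal.ofReal_le_ofReal (by linarith)
  let fN : ℕ → E n → 𝕜 := fun N x => dyaMean a l f N (idx a l N x)
  have hfNsupp : ∀ N x, fN N x ≠ 0 → x ∈ dya a l 0 0 := fun N x hx => by
    obtain ⟨y, hy, hfy⟩ : ∃ y ∈ dya a l N (idx a l N x), f y ≠ 0 := by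
      by_contra! hcon
      refine hx ?_
      simp only [fN, dyaMean]
      rw [setAverage_congr_fun (g := fun _ => 0) (measurableSet_dya _ _ _ _)
        (Eventually.of_forall fun y hy => hcon y hy)]
      simp
    have h1 : idx a l 0 y = 0 := hsupp y hfy
    have h2 : idx a l N y = idx a l N x := hy
    exact (idx_eq_of_le (Nat.zero_le N) h2).symm.trans h1
  have hfNm : ∀ N, Measurable (fN N) := fun N =>
    (measurable_of_countable (dyaMean a l f N)).comp (measurable_idx a l N)
  have hfNM : ∀ N x, ‖fN N x‖ₑ ≤ M := fun N x => enorm_dyaMean_le_of_bounded hl hM _ _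
  have hfNp : ∀ N (p : ℝ≥0∞), MemLp (fN N) p volume := fun N p => by
    refine (memLp_indicator_const p (measurableSet_dya a l 0 0) (M : ℝ)
      (Or.inr (volume_dya_lt_top hl).ne)).mono (hfNm N).aestronglyMeasurable
        (Eventually.of_forall fun x => ?_)
    by_cases hx : x ∈ dya a l 0 0
    · rw [Set.indicator_of_mem hx]
      have := hfNM N x
      rw [enorm_eq_nnnorm, ENNReal.coe_le_coe] at this
      have h2 : ‖fN N x‖ ≤ M := by exact_mod_cast this
      simpa using h2
    · have : fN N x = 0 := by_contra fun h => hx (hfNsupp N x h)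
      simp [this]
  have hconv : Tendsto (fun N => ∫⁻ x, ‖f x - fN N x‖ₑ ^ 2) atTop (𝓝 0) := by
    have := tendsto_lintegral_of_dominated_convergence' (μ := (volume : Measure (E n)))
      (F := fun N x => ‖f x - fN N x‖ₑ ^ 2) (f := fun _ => 0)
      ((dya a l 0 0).indicator fun _ => (2 * (M : ℝ≥0∞)) ^ 2) ?_ ?_ ?_ ?_
    · simpa using this
    · exact fun N => (hf.aestronglyMeasurable.sub (hfNm N).aestronglyMeasurable).enorm.pow_const _
    · refine fun N => Eventually.of_forall fun x => ?_
      by_cases hx : x ∈ dya a l 0 0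
      · rw [Set.indicator_of_mem hx]
        refine pow_le_pow_left' (enorm_sub_le.trans ?_) 2
        rw [two_mul]
        exact add_le_add (hM x) (hfNM N x)
      · have h1 : fN N x = 0 := by_contra fun h => hx (hfNsupp N x h)
        have h2 : f x = 0 := by_contra fun h => hx (hsupp x h)
        simp [h1, h2]
    · rw [lintegral_indicator (measurableSet_dya _ _ _ _), setLIntegral_const]
      exact ENNReal.mul_ne_top (by finiteness) (volume_dya_lt_top hl).ne
    · filter_upwards [tendsto_dyaMean hn hl (a := a) hfi.locallyIntegrable] with x hx
      have h1 : Tendsto (fun N => f x - fN N x) atTop (𝓝 (f x - f x)) := hx.const_sub _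
      rw [sub_self] at h1
      have h2 := (ENNReal.continuous_pow 2).tendsto _ |>.comp h1.enorm
      simpa [Function.comp_def] using h2
  have hbound : ∀ N, volume {x | t < ‖T (hf.toLp f) x‖ₑ} ≤ C * (∫⁻ x, ‖f x‖ₑ) / (t / 2) +
      ‖T‖ₑ ^ 2 * (∫⁻ x, ‖f x - fN N x‖ₑ ^ 2) / (t / 2) ^ 2 := fun N => by
    have h1 := hC a l hl (fN N) (hfNp N 2) (memLp_one_iff_integrable.1 (hfNp N 1)) (hfNsupp N) N
      (fun x y hxy => by simp only [fN, hxy]) (t / 2) ht2 ht2'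
      ((lintegral_dyaMean_le hl f N).trans htop)
    have h2 := measure_le_enorm_apply_le T (hf.sub (hfNp N 2)) ht2.ne' ht2'
    have hcov : {x | t < ‖T (hf.toLp f) x‖ₑ} ≤ᵐ[volume]
        ({x | t / 2 < ‖T ((hfNp N 2).toLp (fN N)) x‖ₑ} ∪
          {x | t / 2 ≤ ‖T ((hf.sub (hfNp N 2)).toLp _) x‖ₑ} : Set (E n)) := by
      have e : T (hf.toLp f) = T ((hfNp N 2).toLp (fN N)) + T ((hf.sub (hfNp N 2)).toLp _) := by
        rw [← map_add, ← MemLp.toLp_add]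
        congr 2
        simp
      filter_upwards [Lp.coeFn_add (T ((hfNp N 2).toLp (fN N)))
        (T ((hf.sub (hfNp N 2)).toLp _))] with x hx hxt
      have hxt : t < ‖T (hf.toLp f) x‖ₑ := hxt
      rw [e, hx, Pi.add_apply] at hxt
      by_contra hcon
      have h3 : ¬ t / 2 < ‖T ((hfNp N 2).toLp (fN N)) x‖ₑ := fun h => hcon (Or.inl h)
      have h4 : ¬ t / 2 ≤ ‖T ((hf.sub (hfNp N 2)).toLp _) x‖ₑ := fun h => hcon (Or.inr h)
      have h5 := (hxt.trans_le (enorm_add_le _ _)).trans_le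
        (add_le_add (not_lt.1 h3) (not_le.1 h4).le)
      rw [ENNReal.add_halves] at h5
      exact h5.false
    refine (measure_mono_ae hcov).trans ((measure_union_le _ _).trans (add_le_add ?_ h2))
    refine h1.trans ?_
    exact ENNReal.div_le_div_right (mul_le_mul_right (lintegral_dyaMean_le hl f N) _) _
  have hlim : Tendsto (fun N => C * (∫⁻ x, ‖f x‖ₑ) / (t / 2) +
      ‖T‖ₑ ^ 2 * (∫⁻ x, ‖f x - fN N x‖ₑ ^ 2) / (t / 2) ^ 2) atTop
      (𝓝 (C * (∫⁻ x, ‖f x‖ₑ) / (t / 2) + ‖T‖ₑ ^ 2 * 0 / (t / 2) ^ 2)) := by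
    refine tendsto_const_nhds.add (ENNReal.Tendsto.div_const
      (ENNReal.Tendsto.const_mul hconv (Or.inr (by finiteness))) (Or.inr ?_))
    exact pow_ne_zero 2 ht2.ne'
  refine (ge_of_tendsto' hlim hbound).trans (le_of_eq ?_)
  rw [mul_zero, ENNReal.zero_div, add_zero, ENNReal.div_eq_inv_mul, ENNReal.div_eq_inv_mul,
    ENNReal.div_eq_inv_mul, ENNReal.mul_inv (by simp) (by simp), inv_inv]
  push_cast
  ring

end KernelData

end

/-! ### Local oscillation -/

section

variable {𝕜 : Type*} [RCLike 𝕜] {n : ℕ}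

theorem enorm_trunc_le (f : E n → 𝕜) (k : ℕ) (x : E n) : ‖trunc f k x‖ₑ ≤ ‖f x‖ₑ := by
  by_cases hx : ‖x‖ ≤ k ∧ ‖f x‖ ≤ k <;> simp [trunc, hx]

theorem enorm_trunc_le_const (f : E n → 𝕜) (k : ℕ) (x : E n) :
    ‖trunc f k x‖ₑ ≤ ((k : ℝ≥0) : ℝ≥0∞) := by
  by_cases hx : ‖x‖ ≤ k ∧ ‖f x‖ ≤ k
  · simp only [trunc, Set.mem_ofPred_eq, hx, and_self, Set.indicator_of_mem]
    rw [enorm_eq_nnnorm, ENNReal.coe_le_coe]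
    exact_mod_cast hx.2
  · simp [trunc, hx]

theorem norm_le_of_trunc_ne_zero {f : E n → 𝕜} {k : ℕ} {x : E n} (h : trunc f k x ≠ 0) :
    ‖x‖ ≤ k := by
  by_contra hx
  exact h (by simp [trunc, hx])

namespace KernelData

variable {T : L2 𝕜 n →L[𝕜] L2 𝕜 n}

/-- On a cube `Q`, `T f` differs from a suitable constant by at most a multiple of the averages of
`|f|` over the cubes that contain `Q`, apart from a small portion of `Q`. -/
theorem exists_const_near (D : KernelData T) (hn : 1 ≤ n) {η : ℝ≥0∞} (hη : 0 < η) (hη' : η ≠ ∞) :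
    ∃ C : ℝ≥0, 0 < C ∧
    ∀ (f g : E n → 𝕜) (hf : LocallyIntegrable f volume), HasValue T hf g →
    ∀ (a : E n) (r : ℝ), 0 < r → ∀ B : ℝ≥0, 0 < B →
    (∀ (a' : E n) (r' : ℝ), 0 < r' → cube a r ⊆ cube a' r' → avg a' r' (fun y => ‖f y‖ₑ) ≤ B) →
    ∃ c : 𝕜, volume (cube a r ∩ {x | C * B < ‖g x - c‖ₑ}) ≤ η * volume (cube a r) := by
  obtain ⟨C₁, hC₁⟩ := D.weakType hn
  obtain ⟨C₂, hC₂⟩ := D.enorm_sub_le_near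
  have hη2 : 0 < η / 2 := ENNReal.half_pos hη.ne'
  have hη2' : η / 2 ≠ ∞ := (ENNReal.div_lt_top hη' two_ne_zero).ne
  have hn' : (0 : ℝ) < n := by exact_mod_cast hn
  have hn1 : (1 : ℝ) ≤ n := by exact_mod_cast hn
  -- the height at which the weak type estimate gains the factor `η / 2`
  obtain ⟨s, hs0, hs⟩ : ∃ s : ℝ≥0, 0 < s ∧ (C₁ * (3 * n) ^ n : ℝ≥0∞) ≤ s * (η / 2) := by
    have hfin : (C₁ * (3 * n) ^ n : ℝ≥0∞) / (η / 2) ≠ ∞ :=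
      (ENNReal.div_lt_top (by finiteness) hη2.ne').ne
    refine ⟨((C₁ * (3 * n) ^ n : ℝ≥0∞) / (η / 2)).toNNReal + 1, by positivity, ?_⟩
    rw [ENNReal.coe_add, ENNReal.coe_toNNReal hfin, add_mul,
      ENNReal.div_mul_cancel hη2.ne' hη2']
    exact le_self_add
  refine ⟨s + C₂ + 1, by positivity, fun f g hf hg a r hr B hB havg => ?_⟩
  have hB' : (B : ℝ≥0∞) ≠ 0 := by simpa using hB.ne'
  set R : ℝ := 3 * n * r with hR
  have hrR : r ≤ R := by nlinarith
  have hR0 : 0 < R := by positivity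
  have hQpos := volume_cube_pos a hr
  have hQfin := volume_cube_lt_top a r
  have hball : cube a r ⊆ Metric.ball 0 (‖a‖ + n * r + 1) := fun x hx => by
    have h1 := mem_closedBall_iff_norm.1 (cube_subset_closedBall a hr.le hx)
    rw [mem_ball_zero_iff]
    have := norm_le_norm_add_norm_sub' x a
    linarith
  have hlim := hg.2 (‖a‖ + n * r + 1) B (by exact_mod_cast hB)
  have hev := hlim.eventually_le_const (ENNReal.mul_pos hη2.ne' hQpos.ne')
  obtain ⟨k, hk⟩ := hev.exists
  have hcube_m : MeasurableSet (cube a R) := (isClosed_cube a R).measurableSet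
  set F := trunc f k with hF
  have hF2 := memLp_trunc hf k
  have h1p : MemLp ((cube a R).indicator F) 2 volume := hF2.indicator hcube_m
  have h2p : MemLp ((cube a R)ᶜ.indicator F) 2 volume := hF2.indicator hcube_m.compl
  have hFle : ∀ (s : Set (E n)) x, ‖s.indicator F x‖ₑ ≤ ‖F x‖ₑ := fun s x => by
    by_cases hx : x ∈ s <;> simp [hx]
  have hFne : ∀ (s : Set (E n)) x, s.indicator F x ≠ 0 → ‖x‖ ≤ k := fun s x hx => by
    refine norm_le_of_trunc_ne_zero (f := f) fun h => hx ?_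
    by_cases hxs : x ∈ s <;> simp [hxs, hF, h]
  have hcs2 : HasCompactSupport ((cube a R)ᶜ.indicator F) :=
    hasCompactSupport_of_closedBall (y₀ := 0) (d := k) fun y hy => by
      rw [sub_zero]; exact hFne _ y hy
  -- the part of `f` far from the cube
  have hfar := hC₂ _ h2p a R B hR0 hcs2 (fun y hy => by
      by_contra! hlt
      have hyc : y ∈ cube a R := closedBall_subset_cube _ _ (mem_closedBall_iff_norm.2 hlt.le)
      exact hy (Set.indicator_of_notMem (fun h : y ∈ (cube a R)ᶜ => h hyc) _)) fun r' hr' => by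
    refine le_trans ?_ (havg a r' (by linarith) fun y hy i => (hy i).trans (hrR.trans hr'))
    exact ENNReal.div_le_div_right (lintegral_mono fun y => (hFle _ y).trans
      (enorm_trunc_le f k y)) _
  set c := ∫ y, D.K a y * (cube a R)ᶜ.indicator F y with hc
  -- the part of `f` near the cube
  have hnear : volume {x | s * B < ‖T (h1p.toLp _) x‖ₑ} ≤ η / 2 * volume (cube a r) := by
    have hI : ∫⁻ x, ‖(cube a R).indicator F x‖ₑ ≤ B * ((3 * n) ^ n * volume (cube a r)) := by
      calc _ ≤ ∫⁻ x in cube a R, ‖f x‖ₑ := by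
            rw [← lintegral_indicator hcube_m]
            refine lintegral_mono fun x => ?_
            by_cases hx : x ∈ cube a R
            · simpa [hx] using enorm_trunc_le f k x
            · simp [hx]
        _ ≤ B * volume (cube a R) :=
            (ENNReal.div_le_iff (volume_cube_pos a hR0).ne' (volume_cube_lt_top a R).ne).1
              (havg a R hR0 fun y hy i => (hy i).trans hrR)
        _ = _ := by
            rw [hR, volume_cube_mul a a (by positivity)]
            congr 3
            rw [ENNReal.ofReal_mul (by norm_num), ENNReal.ofReal_natCast]
            norm_num
    refine (hC₁ _ h1p k (fun x => (hFle _ x).trans (enorm_trunc_le_const f k x)) k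
      (hFne _) (s * B) (ENNReal.mul_pos (by simpa using hs0.ne') hB') (by finiteness)).trans ?_
    refine ENNReal.div_le_of_le_mul ?_
    calc _ ≤ C₁ * (B * ((3 * n) ^ n * volume (cube a r))) := by gcongr
      _ = (C₁ * (3 * n) ^ n) * (B * volume (cube a r)) := by ring
      _ ≤ s * (η / 2) * (B * volume (cube a r)) := by gcongr
      _ = _ := by ring
  rw [Measure.restrict_apply' Metric.isOpen_ball.measurableSet] at hk
  refine ⟨c, ?_⟩
  have hcov : (cube a r ∩ {x | ((s + C₂ + 1 : ℝ≥0) : ℝ≥0∞) * B < ‖g x - c‖ₑ} : Set (E n))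
      ≤ᵐ[volume] ({x | (B : ℝ≥0∞) ≤ edist (T ((memLp_trunc hf k).toLp (trunc f k)) x) (g x)} ∩
        Metric.ball 0 (‖a‖ + n * r + 1) ∪ {x | s * B < ‖T (h1p.toLp _) x‖ₑ} : Set (E n)) := by
    have e : T ((memLp_trunc hf k).toLp (trunc f k)) = T (h1p.toLp _) + T (h2p.toLp _) := by
      rw [← map_add, ← MemLp.toLp_add]
      congr 2
      exact (Set.indicator_self_add_compl _ _).symm
    filter_upwards [hfar, Lp.coeFn_add (T (h1p.toLp _)) (T (h2p.toLp _))] with x hx hadd hxg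
    have hxQ : x ∈ cube a r := hxg.1
    have hxg : ((s + C₂ + 1 : ℝ≥0) : ℝ≥0∞) * B < ‖g x - c‖ₑ := hxg.2
    have h2 := hx (by
      have := mem_closedBall_iff_norm.1 (cube_subset_closedBall a hr.le hxQ)
      have : 0 < n * r := by positivity
      rw [hR]
      linarith)
    by_contra hcon
    have h3 : ¬ (B : ℝ≥0∞) ≤ edist (T ((memLp_trunc hf k).toLp (trunc f k)) x) (g x) :=
      fun h => hcon (Or.inl ⟨h, hball hxQ⟩)
    have h4 : ¬ s * B < ‖T (h1p.toLp _) x‖ₑ := fun h => hcon (Or.inr h)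
    rw [e, hadd, Pi.add_apply] at h3
    rw [edist_comm, edist_eq_enorm_sub] at h3
    have h5 : ‖g x - c‖ₑ ≤ B + (s * B + C₂ * B) := by
      calc ‖g x - c‖ₑ = ‖(g x - (T (h1p.toLp _) x + T (h2p.toLp _) x)) +
            (T (h1p.toLp _) x + (T (h2p.toLp _) x - c))‖ₑ := by congr 1; ring
        _ ≤ _ := (enorm_add_le _ _).trans (add_le_add (not_le.1 h3).le
            ((enorm_add_le _ _).trans (add_le_add (not_lt.1 h4) h2)))
    refine (hxg.trans_le h5).ne ?_
    push_cast
    ring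
  refine (measure_mono_ae hcov).trans ((measure_union_le _ _).trans
    ((add_le_add hk hnear).trans (le_of_eq ?_)))
  rw [← add_mul, ENNReal.add_halves]

end KernelData

end

/-! ### Stopping cubes -/

section

section Stopping

variable {X ι F : Type*} [NormedAddCommGroup F] (π : ι → ι) (c : ℕ → ι → F) (A : ℕ → ι → ℝ≥0)

open Classical in
/-- The last stopping cube above the cube of generation `k` with index `m`, as a pair of a
generation and an index. The cubes of generation `0` are stopping cubes; below a stopping cube `Q`
the next ones are the maximal cubes `P` for which `c P` is not within `A Q + A P` of `c Q`. -/
noncomputable def base : ℕ → ι → ℕ × ι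
  | 0, m => (0, m)
  | k + 1, m =>
    if A (base k (π m)).1 (base k (π m)).2 + A (k + 1) m <
        ‖c (k + 1) m - c (base k (π m)).1 (base k (π m)).2‖₊
    then (k + 1, m) else base k (π m)

/-- The cube of generation `k` with index `m` is a stopping cube. -/
def Stop (k : ℕ) (m : ι) : Prop := base π c A k m = (k, m)

open Classical in
/-- The sum of the `A Q` over the stopping cubes `Q` above a cube. -/
noncomputable def stopSum : ℕ → ι → ℝ≥0
  | 0, m => A 0 m
  | k + 1, m => stopSum k (π m) + if Stop π c A (k + 1) m then A (k + 1) m else 0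

/-- The index of the cube of generation `0` above a cube of generation `k`. -/
def root : ℕ → ι → ι
  | 0, m => m
  | k + 1, m => root k (π m)

variable {π c A} {k : ℕ} {m : ι}

theorem base_fst_le (k : ℕ) (m : ι) : (base π c A k m).1 ≤ k := by
  induction k generalizing m with
  | zero => exact le_rfl
  | succ k ih =>
    rw [base]
    split_ifs
    · exact le_rfl
    · exact (ih _).trans (Nat.le_succ k)

theorem base_succ_of_not_stop (h : ¬ Stop π c A (k + 1) m) :
    base π c A (k + 1) m = base π c A k (π m) := by
  rw [Stop, base] at h
  rw [base]
  split_ifs at h ⊢ with h1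
  · exact (h rfl).elim
  · rfl

theorem lt_of_stop_succ (h : Stop π c A (k + 1) m) :
    A (base π c A k (π m)).1 (base π c A k (π m)).2 + A (k + 1) m <
      ‖c (k + 1) m - c (base π c A k (π m)).1 (base π c A k (π m)).2‖₊ := by
  rw [Stop, base] at h
  split_ifs at h with h1
  · exact h1
  · have h2 := base_fst_le (π := π) (c := c) (A := A) k (π m)
    rw [h] at h2
    exact absurd h2 (by simp)

theorem A_base_le (hA : ∀ k m, A k (π m) ≤ A (k + 1) m) (k : ℕ) (m : ι) :
    A (base π c A k m).1 (base π c A k m).2 ≤ A k m := by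
  induction k generalizing m with
  | zero => exact le_rfl
  | succ k ih =>
    by_cases h : Stop π c A (k + 1) m
    · rw [show base π c A (k + 1) m = _ from h]
    · rw [base_succ_of_not_stop h]
      exact (ih _).trans (hA k m)

theorem nnnorm_sub_base_le (k : ℕ) (m : ι) : ‖c k m - c (base π c A k m).1 (base π c A k m).2‖₊ ≤
    A (base π c A k m).1 (base π c A k m).2 + A k m := by
  cases k with
  | zero => simp [base]
  | succ k =>
    by_cases h : Stop π c A (k + 1) m
    · rw [show base π c A (k + 1) m = _ from h]
      simp
    · rw [base_succ_of_not_stop h]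
      rw [Stop, base] at h
      split_ifs at h with h1
      · exact (h rfl).elim
      · exact not_lt.1 h1

/-- The jumps of `c` along the stopping cubes are controlled by the `A Q`. -/
theorem norm_base_sub_root_le (hA : ∀ k m, A k (π m) ≤ A (k + 1) m)
    (hstep : ∀ k m, ‖c (k + 1) m - c k (π m)‖ ≤ A (k + 1) m + A k (π m)) (k : ℕ) (m : ι) :
    ‖c (base π c A k m).1 (base π c A k m).2 - c 0 (root π k m)‖ ≤ 4 * stopSum π c A k m := by
  induction k generalizing m with
  | zero => simp [base, root]
  | succ k ih =>
    by_cases h : Stop π c A (k + 1) m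
    · rw [show base π c A (k + 1) m = _ from h]
      have h1 := ih (π m)
      have h2 : ‖c k (π m) - c (base π c A k (π m)).1 (base π c A k (π m)).2‖ ≤
          A (base π c A k (π m)).1 (base π c A k (π m)).2 + A k (π m) :=
        nnnorm_sub_base_le k (π m)
      have h3 := hstep k m
      have h4 : (A (base π c A k (π m)).1 (base π c A k (π m)).2 : ℝ) ≤ A k (π m) :=
        A_base_le hA k (π m)
      have h5 : (A k (π m) : ℝ) ≤ A (k + 1) m := hA k m
      have h6 := norm_sub_le_norm_sub_add_norm_sub (c (k + 1) m) (c k (π m)) (c 0 (root π k (π m)))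
      have h7 := norm_sub_le_norm_sub_add_norm_sub (c k (π m))
        (c (base π c A k (π m)).1 (base π c A k (π m)).2) (c 0 (root π k (π m)))
      simp only [root, stopSum, h, if_true, NNReal.coe_add]
      linarith
    · rw [base_succ_of_not_stop h]
      simpa [root, stopSum, h] using ih (π m)

theorem norm_sub_root_le (hA : ∀ k m, A k (π m) ≤ A (k + 1) m)
    (hstep : ∀ k m, ‖c (k + 1) m - c k (π m)‖ ≤ A (k + 1) m + A k (π m)) (k : ℕ) (m : ι) :
    ‖c k m - c 0 (root π k m)‖ ≤ 4 * stopSum π c A k m + 2 * A k m := by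
  have h1 := norm_base_sub_root_le hA hstep k m
  have h2 : ‖c k m - c (base π c A k m).1 (base π c A k m).2‖ ≤
      A (base π c A k m).1 (base π c A k m).2 + A k m := nnnorm_sub_base_le k m
  have h3 : (A (base π c A k m).1 (base π c A k m).2 : ℝ) ≤ A k m := A_base_le hA k m
  have h4 := norm_sub_le_norm_sub_add_norm_sub (c k m)
    (c (base π c A k m).1 (base π c A k m).2) (c 0 (root π k m))
  linarith

theorem stopSum_mono (k : ℕ) (m : ι) : stopSum π c A k (π m) ≤ stopSum π c A (k + 1) m := by
  rw [stopSum]; exact le_self_add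

theorem A_zero_le_stopSum (k : ℕ) (m : ι) : A 0 (root π k m) ≤ stopSum π c A k m := by
  induction k generalizing m with
  | zero => exact le_rfl
  | succ k ih => exact (ih (π m)).trans (stopSum_mono k m)

theorem stopSum_le (hA : ∀ k m, A k (π m) ≤ A (k + 1) m) (k : ℕ) (m : ι) :
    stopSum π c A k m ≤ (k + 1) * A k m := by
  induction k generalizing m with
  | zero => simp [stopSum]
  | succ k ih =>
    rw [stopSum]
    have h1 : stopSum π c A k (π m) ≤ (k + 1) * A (k + 1) m :=
      (ih _).trans (by gcongr; exact hA k m)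
    have h2 : stopSum π c A k (π m) + A (k + 1) m ≤ ((k + 1 : ℕ) + 1) * A (k + 1) m := by
      refine (add_le_add h1 le_rfl).trans (le_of_eq ?_)
      push_cast
      ring
    split_ifs
    · exact h2
    · exact (add_le_add le_rfl zero_le).trans h2

variable {idx : ℕ → X → ι} (hπ : ∀ k x, π (idx (k + 1) x) = idx k x)

include hπ in
theorem root_idx (k : ℕ) (x : X) : root π k (idx k x) = idx 0 x := by
  induction k with
  | zero => rfl
  | succ k ih => rw [root, hπ, ih]

include hπ in
theorem idx_eq_of_idx_eq {j k : ℕ} (hjk : j ≤ k) {x y : X} (h : idx k x = idx k y) :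
    idx j x = idx j y := by
  induction k, hjk using Nat.le_induction with
  | base => exact h
  | succ k _ ih => exact ih (by rw [← hπ k x, h, hπ])

variable [MeasurableSpace X] [Countable ι] [MeasurableSpace ι] [MeasurableSingletonClass ι]
  (hidx : ∀ k, Measurable (idx k)) {ν μ : Measure X} {g : X → F}
  (hfin : ∀ k m, ν (idx k ⁻¹' {m}) < ∞)
  (hE : ∀ k m, ν (idx k ⁻¹' {m} ∩ {x | A k m < ‖g x - c k m‖₊}) ≤ ν (idx k ⁻¹' {m}) / 4)

include hπ hidx hfin hE in
/-- Below a stopping cube `Q`, the next stopping cubes are mostly contained in the set on which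
`g` is far from `c Q`. -/
theorem measure_ne_base_le (j : ℕ) (m : ι) (hs : Stop π c A j m) (N : ℕ) (hN : j ≤ N) :
    ν {x | idx j x = m ∧ base π c A N (idx N x) ≠ (j, m)} ≤
      2 * ν ({x | A j m < ‖g x - c j m‖₊} ∩
        {x | idx j x = m ∧ base π c A N (idx N x) ≠ (j, m)}) := by
  induction N, hN using Nat.le_induction with
  | base =>
    have : {x | idx j x = m ∧ base π c A j (idx j x) ≠ (j, m)} = ∅ := by
      ext x
      simp only [Set.mem_ofPred_eq, Set.mem_empty_iff_false, iff_false, not_and, not_not]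
      rintro rfl
      exact hs
    rw [this]
    simp
  | succ N hN ih =>
    set E := {x | A j m < ‖g x - c j m‖₊} with hEdef
    set B : ℕ → Set X := fun N => {x | idx j x = m ∧ base π c A N (idx N x) ≠ (j, m)} with hB
    change ν (B (N + 1)) ≤ 2 * ν (E ∩ B (N + 1))
    have ih : ν (B N) ≤ 2 * ν (E ∩ B N) := ih
    have hBm : MeasurableSet (B N) :=
      (hidx j (measurableSet_singleton m)).inter
        (hidx N ((Set.to_countable {m' | base π c A N m' ≠ (j, m)}).measurableSet))
    have hsub : B N ⊆ B (N + 1) := fun x hx => by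
      refine ⟨hx.1, fun h => ?_⟩
      by_cases hst : Stop π c A (N + 1) (idx (N + 1) x)
      · have := (show base π c A (N + 1) (idx (N + 1) x) = _ from hst).symm.trans h
        have := congrArg Prod.fst this
        simp only at this
        omega
      · rw [base_succ_of_not_stop hst, hπ] at h
        exact hx.2 h
    -- the cubes that are stopped in generation `N + 1`
    have hnew : ν (B (N + 1) \ B N) ≤ 2 * ν ((E ∩ B (N + 1)) \ B N) := by
      refine measure_le_of_cells (hidx (N + 1)) fun m' => ?_
      by_cases hex : ∃ x, idx (N + 1) x = m' ∧ x ∈ B (N + 1) \ B N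
      swap
      · have : (B (N + 1) \ B N) ∩ idx (N + 1) ⁻¹' {m'} = ∅ := by
          ext x
          simp only [Set.mem_inter_iff, Set.mem_empty_iff_false, iff_false]
          exact fun hx => hex ⟨x, hx.2, hx.1⟩
        rw [this]
        simp
      obtain ⟨x, rfl, hx, hx'⟩ := hex
      have hbx : base π c A N (idx N x) = (j, m) := by
        by_contra h
        exact hx' ⟨hx.1, h⟩
      have hst : Stop π c A (N + 1) (idx (N + 1) x) := by
        by_contra h
        refine hx.2 ?_
        rw [base_succ_of_not_stop h, hπ, hbx]
      have hall : ∀ y, idx (N + 1) y = idx (N + 1) x → y ∈ B (N + 1) \ B N := fun y hy => by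
        have h1 : idx j y = m := (idx_eq_of_idx_eq hπ (by omega) hy).trans hx.1
        refine ⟨⟨h1, by rw [hy]; exact hx.2⟩, fun h => h.2 ?_⟩
        rw [idx_eq_of_idx_eq hπ (Nat.le_succ N) hy, hbx]
      have hlt := lt_of_stop_succ hst
      rw [hπ, hbx] at hlt
      set P := idx (N + 1) ⁻¹' {idx (N + 1) x} with hP
      have hcov : P ⊆ ((E ∩ B (N + 1)) \ B N) ∩ P ∪
          P ∩ {y | A (N + 1) (idx (N + 1) x) < ‖g y - c (N + 1) (idx (N + 1) x)‖₊} := by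
        intro y hy
        have hyB := hall y hy
        by_cases h1 : A j m < ‖g y - c j m‖₊
        · exact Or.inl ⟨⟨⟨h1, hyB.1⟩, hyB.2⟩, hy⟩
        by_cases h2 : A (N + 1) (idx (N + 1) x) < ‖g y - c (N + 1) (idx (N + 1) x)‖₊
        · exact Or.inr ⟨hy, h2⟩
        exfalso
        have h3 : ‖c (N + 1) (idx (N + 1) x) - c j m‖₊ ≤
            ‖g y - c (N + 1) (idx (N + 1) x)‖₊ + ‖g y - c j m‖₊ := by
          calc _ = ‖-(g y - c (N + 1) (idx (N + 1) x)) + (g y - c j m)‖₊ := by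
                congr 1; abel
            _ ≤ _ := (nnnorm_add_le _ _).trans (by rw [nnnorm_neg])
        refine (hlt.trans_le (h3.trans ?_)).ne rfl
        rw [add_comm]
        exact add_le_add (not_lt.1 h1) (not_lt.1 h2)
      have h5 : ν P ≤ ν (((E ∩ B (N + 1)) \ B N) ∩ P) + ν P / 4 :=
        (measure_mono hcov).trans ((measure_union_le _ _).trans
          (by gcongr; exact hE (N + 1) (idx (N + 1) x)))
      have h6 : ν P ≤ 2 * ν (((E ∩ B (N + 1)) \ B N) ∩ P) := by
        have hPf : ν P < ∞ := hfin (N + 1) (idx (N + 1) x)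
        have hPf2 : ν (((E ∩ B (N + 1)) \ B N) ∩ P) < ∞ :=
          (measure_mono Set.inter_subset_right).trans_lt hPf
        have h7 := (ENNReal.toReal_le_toReal hPf.ne (by finiteness)).2 h5
        rw [ENNReal.toReal_add hPf2.ne (by finiteness), ENNReal.toReal_div] at h7
        refine (ENNReal.toReal_le_toReal hPf.ne (by finiteness)).1 ?_
        rw [ENNReal.toReal_mul]
        norm_num at h7 ⊢
        linarith [ENNReal.toReal_nonneg (a := ν (((E ∩ B (N + 1)) \ B N) ∩ P))]
      exact (measure_mono Set.inter_subset_right).trans h6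
    calc ν (B (N + 1)) = ν (B (N + 1) ∩ B N) + ν (B (N + 1) \ B N) :=
          (measure_inter_add_sdiff _ hBm).symm
      _ = ν (B N) + ν (B (N + 1) \ B N) := by rw [Set.inter_eq_right.2 hsub]
      _ ≤ 2 * ν (E ∩ B N) + 2 * ν ((E ∩ B (N + 1)) \ B N) := add_le_add ih hnew
      _ = 2 * (ν ((E ∩ B (N + 1)) ∩ B N) + ν ((E ∩ B (N + 1)) \ B N)) := by
          rw [mul_add, Set.inter_assoc, Set.inter_eq_right.2 hsub]
      _ = _ := by rw [measure_inter_add_sdiff _ hBm]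

include hπ hidx hfin hE in
/-- The stopping cubes form a sparse family. -/
theorem measure_stop_le (j : ℕ) (m : ι) (hs : Stop π c A j m) (N : ℕ) (hN : j ≤ N) :
    ν (idx j ⁻¹' {m}) ≤ 2 * ν {x | idx j x = m ∧ base π c A N (idx N x) = (j, m)} := by
  have h1 := measure_ne_base_le hπ hidx hfin hE j m hs N hN
  have h2 : ν ({x | A j m < ‖g x - c j m‖₊} ∩
      {x | idx j x = m ∧ base π c A N (idx N x) ≠ (j, m)}) ≤ ν (idx j ⁻¹' {m}) / 4 := by
    refine le_trans (measure_mono ?_) (hE j m)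
    exact fun x hx => ⟨hx.2.1, hx.1⟩
  have h3 : ν (idx j ⁻¹' {m}) ≤ ν {x | idx j x = m ∧ base π c A N (idx N x) ≠ (j, m)} +
      ν {x | idx j x = m ∧ base π c A N (idx N x) = (j, m)} := by
    refine (measure_mono fun x hx => ?_).trans (measure_union_le _ _)
    by_cases h : base π c A N (idx N x) = (j, m)
    · exact Or.inr ⟨hx, h⟩
    · exact Or.inl ⟨hx, h⟩
  have hf := hfin j m
  have hf2 : ν {x | idx j x = m ∧ base π c A N (idx N x) = (j, m)} < ∞ :=
    (measure_mono fun x hx => hx.1).trans_lt hf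
  have h4 : ν (idx j ⁻¹' {m}) ≤ 2 * (ν (idx j ⁻¹' {m}) / 4) +
      ν {x | idx j x = m ∧ base π c A N (idx N x) = (j, m)} :=
    h3.trans (add_le_add (h1.trans (by gcongr)) le_rfl)
  have h7 := (ENNReal.toReal_le_toReal hf.ne (by finiteness)).2 h4
  rw [ENNReal.toReal_add (by finiteness) hf2.ne, ENNReal.toReal_mul, ENNReal.toReal_div] at h7
  refine (ENNReal.toReal_le_toReal hf.ne (by finiteness)).1 ?_
  rw [ENNReal.toReal_mul]
  norm_num at h7 ⊢
  linarith

end Stopping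

end

/-! ### The Carleson embedding -/

section

section Carleson

variable {X ι F : Type*} [NormedAddCommGroup F] {π : ι → ι} {c : ℕ → ι → F} {A : ℕ → ι → ℝ≥0}
  {idx : ℕ → X → ι} (hπ : ∀ k x, π (idx (k + 1) x) = idx k x)
  [MeasurableSpace X] [Countable ι] [MeasurableSpace ι] [MeasurableSingletonClass ι]
  (hidx : ∀ k, Measurable (idx k)) {ν μ : Measure X} {g : X → F}
  (hfin : ∀ k m, ν (idx k ⁻¹' {m}) < ∞)
  (hpos : ∀ k m, ν (idx k ⁻¹' {m}) ≠ 0)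
  (hE : ∀ k m, ν (idx k ⁻¹' {m} ∩ {x | A k m < ‖g x - c k m‖₊}) ≤ ν (idx k ⁻¹' {m}) / 4)
  {Λ : ℝ≥0∞}
  (hΛ : ∀ j m, ∫⁻ x in idx j ⁻¹' {m}, (⨆ (k) (_ : j ≤ k), μ (idx k ⁻¹' {idx k x}) /
    ν (idx k ⁻¹' {idx k x})) ∂ν ≤ Λ * μ (idx j ⁻¹' {m}))

include hidx in
theorem measurableSet_stop (k : ℕ) : MeasurableSet {x | Stop π c A k (idx k x)} :=
  hidx k (Set.to_countable {m | Stop π c A k m}).measurableSet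

include hπ hidx hfin hpos hE hΛ in
/-- The Carleson condition for the stopping cubes with respect to a measure `μ` whose density
satisfies Wilson's condition. -/
theorem sum_measure_stop_le (j : ℕ) (m : ι) (N : ℕ) :
    ∑ k ∈ Finset.Ico j (N + 1), μ (idx j ⁻¹' {m} ∩ {x | Stop π c A k (idx k x)}) ≤
      2 * Λ * μ (idx j ⁻¹' {m}) := by
  classical
  let av : ℕ → ι → ℝ≥0∞ := fun k m => μ (idx k ⁻¹' {m}) / ν (idx k ⁻¹' {m})
  let G : ℕ → X → ℝ≥0∞ := fun k x =>
    if base π c A N (idx N x) = (k, idx k x) then av k (idx k x) else 0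
  have hD : MeasurableSet (idx j ⁻¹' {m}) := hidx j (measurableSet_singleton m)
  have hGset : ∀ k m', MeasurableSet {x | idx k x = m' ∧ base π c A N (idx N x) = (k, m')} :=
    fun k m' => (hidx k (measurableSet_singleton m')).inter
      (hidx N ((Set.to_countable {m'' | base π c A N m'' = (k, m')}).measurableSet))
  have hGm : ∀ k, Measurable (G k) := fun k => by
    refine Measurable.ite ?_ ((measurable_of_countable (av k)).comp (hidx k)) measurable_const
    have : {x | base π c A N (idx N x) = (k, idx k x)} =
        ⋃ m', {x | idx k x = m' ∧ base π c A N (idx N x) = (k, m')} := by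
      ext x
      simp only [Set.mem_ofPred_eq, Set.mem_iUnion, exists_eq_left']
    rw [this]
    exact MeasurableSet.iUnion fun m' => hGset k m'
  have key : ∀ k ∈ Finset.Ico j (N + 1), μ (idx j ⁻¹' {m} ∩ {x | Stop π c A k (idx k x)}) ≤
      2 * ∫⁻ x in idx j ⁻¹' {m}, G k x ∂ν := fun k hk => by
    rw [Finset.mem_Ico] at hk
    have hSm := hD.inter (measurableSet_stop (π := π) (c := c) (A := A) hidx k)
    rw [← lintegral_indicator_one hSm, ← lintegral_const_mul _ (hGm k)]
    rw [← lintegral_indicator hD]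
    refine lintegral_le_of_cells (hidx k) fun m' => ?_
    by_cases hex : ∃ x, idx k x = m' ∧ idx j x = m ∧ Stop π c A k (idx k x)
    swap
    · rw [setLIntegral_congr_fun (g := fun _ => 0) (hidx k (measurableSet_singleton m'))
        fun x hx => Set.indicator_of_notMem (fun h => hex ⟨x, hx, h.1, h.2⟩) _]
      simp
    obtain ⟨x, rfl, hxj, hst⟩ := hex
    have hsub : idx k ⁻¹' {idx k x} ⊆ idx j ⁻¹' {m} := fun y hy =>
      (idx_eq_of_idx_eq hπ hk.1 hy).trans hxj
    calc _ ≤ ∫⁻ y in idx k ⁻¹' {idx k x}, 1 ∂μ :=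
          lintegral_mono fun y => Set.indicator_le_self' (by simp) y
      _ = av k (idx k x) * ν (idx k ⁻¹' {idx k x}) := by
          rw [setLIntegral_one, ENNReal.div_mul_cancel (hpos _ _) (hfin _ _).ne]
      _ ≤ av k (idx k x) * (2 * ν {y | idx k y = idx k x ∧
            base π c A N (idx N y) = (k, idx k x)}) := by
          gcongr
          exact measure_stop_le hπ hidx hfin hE k _ hst N (by omega)
      _ = ∫⁻ y, {y | idx k y = idx k x ∧ base π c A N (idx N y) = (k, idx k x)}.indicator
            (fun _ => 2 * av k (idx k x)) y ∂ν := by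
          rw [lintegral_indicator (hGset _ _), setLIntegral_const]
          ring
      _ ≤ ∫⁻ y, (idx k ⁻¹' {idx k x}).indicator
            ((idx j ⁻¹' {m}).indicator fun y => 2 * G k y) y ∂ν := by
          refine lintegral_mono fun y => ?_
          by_cases hy : idx k y = idx k x ∧ base π c A N (idx N y) = (k, idx k x)
          · have hyk : y ∈ idx k ⁻¹' {idx k x} := hy.1
            rw [Set.indicator_of_mem hyk, Set.indicator_of_mem (hsub hyk)]
            refine (Set.indicator_le_self' (fun _ _ => zero_le) y).trans ?_
            simp only [G, hy.1, hy.2, if_true, le_refl]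
          · rw [Set.indicator_of_notMem (by exact hy)]
            exact zero_le
      _ = _ := by rw [lintegral_indicator (hidx k (measurableSet_singleton _))]
  calc _ ≤ ∑ k ∈ Finset.Ico j (N + 1), 2 * ∫⁻ x in idx j ⁻¹' {m}, G k x ∂ν :=
        Finset.sum_le_sum key
    _ = 2 * ∫⁻ x in idx j ⁻¹' {m}, ∑ k ∈ Finset.Ico j (N + 1), G k x ∂ν := by
        rw [lintegral_finsetSum _ fun k _ => hGm k, Finset.mul_sum]
    _ ≤ 2 * ∫⁻ x in idx j ⁻¹' {m}, (⨆ (k) (_ : j ≤ k), μ (idx k ⁻¹' {idx k x}) /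
          ν (idx k ⁻¹' {idx k x})) ∂ν := by
        gcongr with x
        -- only the generation of the last stopping cube above `x` contributes
        have h1 : ∀ k, G k x ≤ if k = (base π c A N (idx N x)).1 then av k (idx k x) else 0 := by
          intro k
          simp only [G]
          split_ifs with h h' h'
          · exact le_rfl
          · exact absurd (congrArg Prod.fst h).symm h'
          · exact zero_le
          · exact le_rfl
        refine (Finset.sum_le_sum fun k _ => h1 k).trans ?_
        rw [Finset.sum_ite_eq']
        split_ifs with h
        · exact le_iSup₂_of_le _ (Finset.mem_Ico.1 h).1 le_rfl
        · exact zero_le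
    _ ≤ _ := by
        rw [mul_assoc]
        gcongr
        exact hΛ j m

include hπ hidx hfin hpos hE hΛ in
/-- The Carleson embedding for functions that increase along the lattice. -/
theorem sum_lintegral_stop_le (φ : ℕ → ι → ℝ≥0∞) (hφ : ∀ k m, φ k (π m) ≤ φ (k + 1) m) (N : ℕ) :
    ∑ k ∈ Finset.range (N + 1), ∫⁻ x in {x | Stop π c A k (idx k x)}, φ k (idx k x) ∂μ ≤
      2 * Λ * ∫⁻ x, φ N (idx N x) ∂μ := by
  classical
  -- the increments of `φ` along the lattice; the sums over the stopping cubes are exchanged with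
  -- the sums of increments
  let δ : ℕ → ι → ℝ≥0∞ := fun k => Nat.casesOn k (φ 0) fun k m => φ (k + 1) m - φ k (π m)
  have hδ : ∀ k x, φ k (idx k x) = ∑ j ∈ Finset.range (k + 1), δ j (idx j x) := fun k x => by
    induction k with
    | zero => simp [δ]
    | succ k ih =>
      rw [Finset.sum_range_succ, ← ih]
      simp only [δ]
      rw [hπ, add_tsub_cancel_of_le]
      rw [← hπ]
      exact hφ k _
  have hδm : ∀ j, Measurable fun x => δ j (idx j x) := fun j =>
    (measurable_of_countable (δ j)).comp (hidx j)
  have hst : ∀ k, MeasurableSet {x | Stop π c A k (idx k x)} := measurableSet_stop hidx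
  have hcell : ∀ j, ∑ k ∈ Finset.Ico j (N + 1),
      ∫⁻ x in {x | Stop π c A k (idx k x)}, δ j (idx j x) ∂μ ≤
        2 * Λ * ∫⁻ x, δ j (idx j x) ∂μ := fun j => by
    have hD : ∀ m, MeasurableSet (idx j ⁻¹' {m}) := fun m => hidx j (measurableSet_singleton m)
    have hc : ∀ κ : Measure X, ∫⁻ x, δ j (idx j x) ∂κ =
        ∑' m, δ j m * κ (idx j ⁻¹' {m}) := fun κ => by
      rw [lintegral_eq_tsum_cells (hidx j)]
      refine tsum_congr fun m => ?_
      rw [setLIntegral_congr_fun (g := fun _ => δ j m) (hD m)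
        fun x hx => by rw [show idx j x = m from hx], setLIntegral_const]
    simp_rw [hc]
    rw [← Summable.tsum_finsetSum fun _ _ => ENNReal.summable, ← ENNReal.tsum_mul_left]
    refine ENNReal.tsum_le_tsum fun m => ?_
    rw [← Finset.mul_sum]
    simp_rw [Measure.restrict_apply (hD m)]
    calc _ ≤ δ j m * (2 * Λ * μ (idx j ⁻¹' {m})) := by
          gcongr
          exact sum_measure_stop_le hπ hidx hfin hpos hE hΛ j m N
      _ = _ := by ring
  calc _ = ∑ k ∈ Finset.range (N + 1), ∑ j ∈ Finset.range (k + 1),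
        ∫⁻ x in {x | Stop π c A k (idx k x)}, δ j (idx j x) ∂μ := by
        refine Finset.sum_congr rfl fun k _ => ?_
        simp_rw [hδ]
        exact lintegral_finsetSum _ fun j _ => hδm j
    _ = ∑ j ∈ Finset.range (N + 1), ∑ k ∈ Finset.Ico j (N + 1),
        ∫⁻ x in {x | Stop π c A k (idx k x)}, δ j (idx j x) ∂μ := by
        refine Finset.sum_comm' fun k j => ?_
        simp only [Finset.mem_range, Finset.mem_Ico]
        omega
    _ ≤ ∑ j ∈ Finset.range (N + 1), 2 * Λ * ∫⁻ x, δ j (idx j x) ∂μ :=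
        Finset.sum_le_sum fun j _ => hcell j
    _ = _ := by
        simp_rw [hδ]
        rw [← Finset.mul_sum, lintegral_finsetSum _ fun j _ => hδm j]

end Carleson

end

/-! ### The sparse operator in `L^p` -/

section

/-- Convexity of `x ^ p`. -/
theorem add_rpow_le_rpow_add_mul {p : ℝ} (hp : 1 ≤ p) (u a : ℝ≥0) :
    ((u + a : ℝ≥0) : ℝ≥0∞) ^ p ≤
      (u : ℝ≥0∞) ^ p + ENNReal.ofReal p * (a * ((u + a : ℝ≥0) : ℝ≥0∞) ^ (p - 1)) := by
  have hreal : ((u : ℝ) + a) ^ p ≤ (u : ℝ) ^ p + p * (a * ((u : ℝ) + a) ^ (p - 1)) := by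
    rcases eq_or_lt_of_le (show (0 : ℝ) ≤ (u : ℝ) + a by positivity) with h | h
    · rw [← h, Real.zero_rpow (by linarith)]
      positivity
    have h1 := one_add_mul_self_le_rpow_one_add (s := -(a / (u + a : ℝ))) (p := p)
      (by rw [neg_le_neg_iff, div_le_one h]; linarith [u.coe_nonneg]) hp
    rw [show 1 + -(a / (u + a : ℝ)) = u / (u + a) by field_simp; ring,
      Real.div_rpow u.coe_nonneg h.le, le_div_iff₀ (by positivity)] at h1
    have h2 : ((u : ℝ) + a) ^ p = (u + a) ^ (p - 1) * (u + a) := by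
      rw [← Real.rpow_add_one h.ne', sub_add_cancel]
    have h3 : (1 + p * -(a / (u + a : ℝ))) * ((u : ℝ) + a) ^ p =
        (u + a) ^ p - p * (a * ((u : ℝ) + a) ^ (p - 1)) := by
      rw [h2]; field_simp; ring
    linarith
  rw [← ENNReal.coe_rpow_of_nonneg _ (by linarith), ← ENNReal.coe_rpow_of_nonneg _ (by linarith),
    ← ENNReal.coe_rpow_of_nonneg _ (by linarith), ENNReal.ofReal]
  norm_cast
  rw [← NNReal.coe_le_coe]
  push_cast
  rwa [Real.coe_toNNReal p (by linarith)]

section Lp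

variable {X ι F : Type*} [NormedAddCommGroup F] {π : ι → ι} {c : ℕ → ι → F} {A : ℕ → ι → ℝ≥0}
  {idx : ℕ → X → ι} (hπ : ∀ k x, π (idx (k + 1) x) = idx k x)

include hπ in
open Classical in
theorem stopSum_idx (N : ℕ) (x : X) : stopSum π c A N (idx N x) = ∑ k ∈ Finset.range (N + 1),
    if Stop π c A k (idx k x) then A k (idx k x) else 0 := by
  induction N with
  | zero => simp [stopSum, Stop, base]
  | succ N ih => rw [stopSum, hπ, ih, Finset.sum_range_succ _ (N + 1)]

include hπ in
theorem apply_idx_le (hA : ∀ k m, A k (π m) ≤ A (k + 1) m) {k N : ℕ} (hk : k ≤ N) (x : X) :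
    A k (idx k x) ≤ A N (idx N x) := by
  induction N, hk using Nat.le_induction with
  | base => exact le_rfl
  | succ N _ ih => exact ih.trans (hπ N x ▸ hA N _)

variable
  [MeasurableSpace X] [Countable ι] [MeasurableSpace ι] [MeasurableSingletonClass ι]
  (hidx : ∀ k, Measurable (idx k)) {ν μ : Measure X} {g : X → F}
  (hfin : ∀ k m, ν (idx k ⁻¹' {m}) < ∞)
  (hpos : ∀ k m, ν (idx k ⁻¹' {m}) ≠ 0)
  (hE : ∀ k m, ν (idx k ⁻¹' {m} ∩ {x | A k m < ‖g x - c k m‖₊}) ≤ ν (idx k ⁻¹' {m}) / 4)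
  {Λ : ℝ≥0∞}
  (hΛ : ∀ j m, ∫⁻ x in idx j ⁻¹' {m}, (⨆ (k) (_ : j ≤ k), μ (idx k ⁻¹' {idx k x}) /
    ν (idx k ⁻¹' {idx k x})) ∂ν ≤ Λ * μ (idx j ⁻¹' {m}))

include hπ hidx hfin hpos hE hΛ in
open Classical in
/-- The Carleson embedding with one more term, which may exceed the last value of `φ`. -/
theorem lintegral_sum_stop_add_le (φ : ℕ → ι → ℝ≥0∞) (hφ : ∀ k m, φ k (π m) ≤ φ (k + 1) m)
    (ψ : ι → ℝ≥0∞) (N : ℕ) (hψ : ∀ m, φ N m ≤ ψ m) :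
    ∫⁻ x, ((∑ k ∈ Finset.range (N + 1),
      if Stop π c A k (idx k x) then φ k (idx k x) else 0) + ψ (idx N x)) ∂μ ≤
      (2 * Λ + 1) * ∫⁻ x, ψ (idx N x) ∂μ := by
  have hst : ∀ k, MeasurableSet {x | Stop π c A k (idx k x)} := measurableSet_stop hidx
  have hm : ∀ k (φ : ι → ℝ≥0∞), Measurable fun x => φ (idx k x) := fun k φ =>
    (measurable_of_countable φ).comp (hidx k)
  rw [lintegral_add_right _ (hm N ψ), add_mul, one_mul,
    lintegral_finsetSum _ fun k _ => Measurable.ite (hst k) (hm k (φ k)) measurable_const]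
  refine add_le_add ?_ le_rfl
  refine le_trans (le_of_eq ?_) ((sum_lintegral_stop_le hπ hidx hfin hpos hE hΛ φ hφ N).trans
    (mul_le_mul_right (lintegral_mono fun x => hψ _) _))
  refine Finset.sum_congr rfl fun k _ => ?_
  rw [← lintegral_indicator (hst k)]
  rfl

include hπ hidx hfin hpos hE hΛ in
/-- The sparse operator built on the stopping cubes is bounded in `L^p(μ)` by the largest of its
terms, linearly in Wilson's constant. -/
theorem lintegral_stopSum_rpow_le (hA : ∀ k m, A k (π m) ≤ A (k + 1) m) {p : ℝ} (hp : 0 < p)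
    (N : ℕ) :
    ∫⁻ x, ((stopSum π c A N (idx N x) + A N (idx N x) : ℝ≥0) : ℝ≥0∞) ^ p ∂μ ≤
      (ENNReal.ofReal (max 1 p) * (2 * Λ + 1)) ^ p * ∫⁻ x, (A N (idx N x) : ℝ≥0∞) ^ p ∂μ := by
  classical
  set Y := ∫⁻ x, (A N (idx N x) : ℝ≥0∞) ^ p ∂μ with hY
  have hm : ∀ k (φ : ι → ℝ≥0∞), Measurable fun x => φ (idx k x) := fun k φ =>
    (measurable_of_countable φ).comp (hidx k)
  have hst : ∀ k, MeasurableSet {x | Stop π c A k (idx k x)} := measurableSet_stop hidx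
  have hAm : AEMeasurable (fun x => (A N (idx N x) : ℝ≥0∞) ^ p) μ :=
    (hm N fun m => (A N m : ℝ≥0∞) ^ p).aemeasurable
  rcases le_total p 1 with hp1 | hp1
  · -- all terms are at most `A N`, hence `A Q ≤ (A Q) ^ p * (A N) ^ (1 - p)`
    set Ψ : X → ℝ≥0∞ := fun x => (∑ k ∈ Finset.range (N + 1),
      if Stop π c A k (idx k x) then (A k (idx k x) : ℝ≥0∞) ^ p else 0) +
        (A N (idx N x) : ℝ≥0∞) ^ p with hΨ
    have hΨm : Measurable Ψ :=
      (Finset.measurable_fun_sum _ fun k _ => Measurable.ite (hst k)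
        (hm k fun m => (A k m : ℝ≥0∞) ^ p) measurable_const).add (hm N fun m => (A N m : ℝ≥0∞) ^ p)
    have hΨY : ∫⁻ x, Ψ x ∂μ ≤ (2 * Λ + 1) * Y :=
      lintegral_sum_stop_add_le hπ hidx hfin hpos hE hΛ (fun k m => (A k m : ℝ≥0∞) ^ p)
        (fun k m => ENNReal.rpow_le_rpow (by exact_mod_cast hA k m) hp.le)
        (fun m => (A N m : ℝ≥0∞) ^ p) N fun m => le_rfl
    have hle : ∀ k ≤ N, ∀ x, A k (idx k x) ≤ A N (idx N x) := fun k hk x =>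
      apply_idx_le hπ hA hk x
    have hsplit : ∀ k ≤ N, ∀ x, (A k (idx k x) : ℝ≥0∞) ≤
        (A k (idx k x) : ℝ≥0∞) ^ p * (A N (idx N x) : ℝ≥0∞) ^ (1 - p) := fun k hk x => by
      calc (A k (idx k x) : ℝ≥0∞) = (A k (idx k x) : ℝ≥0∞) ^ p *
            (A k (idx k x) : ℝ≥0∞) ^ (1 - p) := by
            rw [← ENNReal.rpow_add_of_nonneg _ _ hp.le (by linarith), add_sub_cancel,
              ENNReal.rpow_one]
        _ ≤ _ := by
            gcongr
            exact hle k hk x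
    have hpt : ∀ x, ((stopSum π c A N (idx N x) + A N (idx N x) : ℝ≥0) : ℝ≥0∞) ^ p ≤
        Ψ x ^ p * ((A N (idx N x) : ℝ≥0∞) ^ p) ^ (1 - p) := fun x => by
      have h1 : ((stopSum π c A N (idx N x) + A N (idx N x) : ℝ≥0) : ℝ≥0∞) ≤
          Ψ x * (A N (idx N x) : ℝ≥0∞) ^ (1 - p) := by
        rw [stopSum_idx hπ, hΨ, add_mul, Finset.sum_mul]
        push_cast
        refine add_le_add (Finset.sum_le_sum fun k hk => ?_) (hsplit N le_rfl x)
        split_ifs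
        · exact hsplit k (Nat.lt_succ_iff.1 (Finset.mem_range.1 hk)) x
        · simp
      refine (ENNReal.rpow_le_rpow h1 hp.le).trans (le_of_eq ?_)
      rw [ENNReal.mul_rpow_of_nonneg _ _ hp.le, ← ENNReal.rpow_mul, ← ENNReal.rpow_mul,
        mul_comm (1 - p)]
    calc _ ≤ ∫⁻ x, Ψ x ^ p * ((A N (idx N x) : ℝ≥0∞) ^ p) ^ (1 - p) ∂μ := lintegral_mono hpt
      _ ≤ (∫⁻ x, Ψ x ∂μ) ^ p * Y ^ (1 - p) :=
          ENNReal.lintegral_mul_norm_pow_le hΨm.aemeasurable hAm hp.le (by linarith) (by ring)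
      _ ≤ ((2 * Λ + 1) * Y) ^ p * Y ^ (1 - p) := by gcongr
      _ = _ := by
          rw [ENNReal.mul_rpow_of_nonneg _ _ hp.le, mul_assoc,
            ← ENNReal.rpow_add_of_nonneg _ _ hp.le (by linarith), add_sub_cancel,
            ENNReal.rpow_one, max_eq_left hp1, ENNReal.ofReal_one, one_mul]
  · rw [max_eq_right hp1]
    set K := 2 * Λ + 1 with hK
    have hpe : ENNReal.ofReal p * K ≠ 0 :=
      mul_ne_zero (by simpa using hp) (by simp [hK])
    by_cases hYtop : Y = ∞
    · rw [hYtop, ENNReal.mul_top]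
      · exact le_top
      · exact fun h => hpe ((ENNReal.rpow_eq_zero_iff_of_pos hp).1 h)
    set V : ℕ → ι → ℝ≥0 := stopSum π c A with hV
    let H : ι → ℝ≥0 := fun m => V N m + A N m
    set Z := ∫⁻ x, (H (idx N x) : ℝ≥0∞) ^ p ∂μ with hZ
    -- finiteness of `Z` is what permits to divide by a power of it
    have hZtop : Z ≠ ∞ := by
      refine ne_top_of_le_ne_top (b := ((N + 2 : ℝ≥0) : ℝ≥0∞) ^ p * Y)
        (ENNReal.mul_ne_top (by finiteness) hYtop) ?_
      rw [hY, ← lintegral_const_mul _ (hm N fun m => (A N m : ℝ≥0∞) ^ p)]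
      refine lintegral_mono fun x => ?_
      rw [← ENNReal.mul_rpow_of_nonneg _ _ hp.le, ← ENNReal.coe_mul]
      refine ENNReal.rpow_le_rpow (ENNReal.coe_le_coe.2 ?_) hp.le
      calc H (idx N x) ≤ (N + 1) * A N (idx N x) + A N (idx N x) :=
            add_le_add (stopSum_le hA N _) le_rfl
        _ = _ := by ring
    have hVp : ∀ M x, (V M (idx M x) : ℝ≥0∞) ^ p ≤ ENNReal.ofReal p *
        ∑ k ∈ Finset.range (M + 1), if Stop π c A k (idx k x) then
          (A k (idx k x) : ℝ≥0∞) * (V k (idx k x) : ℝ≥0∞) ^ (p - 1) else 0 := fun M x => by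
      induction M with
      | zero =>
        have := add_rpow_le_rpow_add_mul hp1 0 (A 0 (idx 0 x))
        simpa [hV, stopSum, Stop, base, ENNReal.zero_rpow_of_pos hp] using this
      | succ M ih =>
        rw [Finset.sum_range_succ, mul_add]
        by_cases h : Stop π c A (M + 1) (idx (M + 1) x)
        · rw [if_pos h]
          have e : V (M + 1) (idx (M + 1) x) = V M (idx M x) + A (M + 1) (idx (M + 1) x) := by
            simp [hV, stopSum, h, hπ]
          have := add_rpow_le_rpow_add_mul hp1 (V M (idx M x)) (A (M + 1) (idx (M + 1) x))
          rw [← e] at this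
          exact this.trans (add_le_add ih le_rfl)
        · rw [if_neg h, mul_zero, add_zero]
          have e : V (M + 1) (idx (M + 1) x) = V M (idx M x) := by
            simp [hV, stopSum, h, hπ]
          rw [e]
          exact ih
    have hpt : ∀ x, (H (idx N x) : ℝ≥0∞) ^ p ≤ ENNReal.ofReal p *
        ((∑ k ∈ Finset.range (N + 1), if Stop π c A k (idx k x) then
          (A k (idx k x) : ℝ≥0∞) * (V k (idx k x) : ℝ≥0∞) ^ (p - 1) else 0) +
        (A N (idx N x) : ℝ≥0∞) * (H (idx N x) : ℝ≥0∞) ^ (p - 1)) := fun x => by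
      rw [mul_add]
      exact (add_rpow_le_rpow_add_mul hp1 _ _).trans (add_le_add (hVp N x) le_rfl)
    have hmain : Z ≤ ENNReal.ofReal p * (K * (Y ^ (1 / p) * Z ^ (1 - 1 / p))) := by
      calc Z ≤ _ := lintegral_mono hpt
        _ = _ := lintegral_const_mul' _ _ ENNReal.ofReal_ne_top
        _ ≤ ENNReal.ofReal p * (K * ∫⁻ x, (A N (idx N x) : ℝ≥0∞) *
              (H (idx N x) : ℝ≥0∞) ^ (p - 1) ∂μ) := by
            refine mul_le_mul_right ?_ _
            refine lintegral_sum_stop_add_le hπ hidx hfin hpos hE hΛ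
              (fun k m => (A k m : ℝ≥0∞) * (V k m : ℝ≥0∞) ^ (p - 1)) (fun k m => ?_)
              (fun m => (A N m : ℝ≥0∞) * (H m : ℝ≥0∞) ^ (p - 1)) N fun m => ?_
            · have h1 : (A k (π m) : ℝ≥0∞) ≤ A (k + 1) m := by exact_mod_cast hA k m
              have h2 : (V k (π m) : ℝ≥0∞) ≤ V (k + 1) m := by exact_mod_cast stopSum_mono k m
              exact mul_le_mul' h1 (ENNReal.rpow_le_rpow h2 (by linarith))
            · have h2 : (V N m : ℝ≥0∞) ≤ H m := ENNReal.coe_le_coe.2 le_self_add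
              exact mul_le_mul_right (ENNReal.rpow_le_rpow h2 (by linarith)) _
        _ = ENNReal.ofReal p * (K * ∫⁻ x, ((A N (idx N x) : ℝ≥0∞) ^ p) ^ (1 / p) *
              ((H (idx N x) : ℝ≥0∞) ^ p) ^ (1 - 1 / p) ∂μ) := by
            congr 3
            ext x
            rw [← ENNReal.rpow_mul, ← ENNReal.rpow_mul, mul_one_div_cancel hp.ne',
              ENNReal.rpow_one, mul_sub, mul_one_div_cancel hp.ne', mul_one]
        _ ≤ _ := by
            gcongr
            refine ENNReal.lintegral_mul_norm_pow_le hAm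
              (hm N fun m => (H m : ℝ≥0∞) ^ p).aemeasurable (by positivity) ?_ (by ring)
            rw [sub_nonneg, div_le_one hp]
            exact hp1
    change Z ≤ _
    by_cases hZ0 : Z = 0
    · rw [hZ0]; exact zero_le
    have hq : 0 ≤ 1 - 1 / p := by
      rw [sub_nonneg, div_le_one hp]; exact hp1
    have hZ1 : Z ^ (1 - 1 / p) ≠ 0 := fun h => by
      rcases ENNReal.rpow_eq_zero_iff.1 h with h | h
      · exact hZ0 h.1
      · exact hZtop h.1
    have hZ2 : Z ^ (1 - 1 / p) ≠ ∞ := ENNReal.rpow_ne_top_of_nonneg hq hZtop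
    have hfinal : Z ^ (1 / p) ≤ ENNReal.ofReal p * K * Y ^ (1 / p) := by
      rw [← ENNReal.mul_le_mul_iff_left hZ1 hZ2,
        ← ENNReal.rpow_add_of_nonneg _ _ (by positivity) hq, add_sub_cancel, ENNReal.rpow_one]
      refine hmain.trans (le_of_eq (by ring))
    have := ENNReal.rpow_le_rpow hfinal hp.le
    rwa [ENNReal.mul_rpow_of_nonneg _ _ hp.le, ← ENNReal.rpow_mul, ← ENNReal.rpow_mul,
      one_div_mul_cancel hp.ne', ENNReal.rpow_one, ENNReal.rpow_one] at this

end Lp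

end

/-! ### Weights of the class `A_∞` -/

section

variable {n : ℕ} {w : E n → ℝ≥0}

theorem weightMeasure_cube (w : E n → ℝ≥0) (a : E n) (r : ℝ) :
    weightMeasure w (cube a r) = ∫⁻ y in cube a r, (w y : ℝ≥0∞) :=
  withDensity_apply _ (isClosed_cube a r).measurableSet

theorem avg_le_maximal {h : E n → ℝ≥0∞} {a : E n} {r : ℝ} (hr : 0 < r) {x : E n}
    (hx : x ∈ cube a r) : avg a r h ≤ maximal h x :=
  le_iSup_of_le a (le_iSup_of_le r (le_iSup_of_le hr (le_iSup_of_le hx le_rfl)))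

theorem ApConst.le {q : ℝ} {a : E n} {r : ℝ} (hr : 0 < r) :
    avg a r (fun y => (w y : ℝ≥0∞)) *
      avg a r (fun y => (w y : ℝ≥0∞) ^ (1 - q / (q - 1))) ^ (q - 1) ≤ ApConst q w :=
  le_iSup_of_le a (le_iSup_of_le r (le_iSup_of_le hr le_rfl))

theorem conjExponent_neg {q : ℝ} (hq : 1 < q) : 1 - q / (q - 1) < 0 := by
  rw [sub_neg, one_lt_div (by linarith)]
  linarith

/-- Weights of the class `A_∞` are locally integrable: negative powers of `w` do not vanish. -/
theorem IsAInfty.weightMeasure_cube_lt_top (hw : IsAInfty w) (a : E n) (r : ℝ) (hr : 0 < r) :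
    weightMeasure w (cube a r) < ∞ := by
  obtain ⟨hm, q, hq, hA⟩ := hw
  have hm' : AEMeasurable fun y => (w y : ℝ≥0∞) := hm.coe_nnreal_ennreal
  rw [weightMeasure_cube, lt_top_iff_ne_top]
  intro htop
  have h1 := (ApConst.le (a := a) hr).trans_lt hA
  rw [avg, htop, ENNReal.top_div_of_ne_top (volume_cube_lt_top a r).ne] at h1
  have h2 : avg a r (fun y => (w y : ℝ≥0∞) ^ (1 - q / (q - 1))) ^ (q - 1) = 0 := by
    by_contra h
    rw [ENNReal.top_mul h] at h1
    exact h1.false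
  rw [ENNReal.rpow_eq_zero_iff_of_pos (by linarith), avg, ENNReal.div_eq_zero_iff,
    or_iff_left (volume_cube_lt_top a r).ne, lintegral_eq_zero_iff' (hm'.pow_const _).restrict] at h2
  have h3 : ∀ᵐ y ∂(volume.restrict (cube a r)), False := by
    filter_upwards [h2] with y hy
    simp only [Pi.zero_apply, ENNReal.rpow_eq_zero_iff] at hy
    rcases hy with hy | hy
    · exact hy.2.not_gt (conjExponent_neg hq)
    · exact ENNReal.coe_ne_top hy.1
  rw [eventually_false_iff_eq_bot, ae_eq_bot, Measure.restrict_eq_zero] at h3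
  exact (volume_cube_pos a hr).ne' h3

theorem exists_cube_superset (a : E n) (r : ℝ) (x : E n) : ∃ s, 0 < s ∧ cube a r ⊆ cube x s := by
  refine ⟨|r| + ‖a - x‖ + 1, by positivity, fun y hy i => ?_⟩
  have h1 := hy i
  have h2 := PiLp.norm_apply_le (a - x) i
  rw [Real.norm_eq_abs] at h2
  have h3 : |y i - x i| ≤ |y i - a i| + |a i - x i| := abs_sub_le _ _ _
  have h4 : |(a - x) i| = |a i - x i| := rfl
  linarith [le_abs_self r]

theorem exists_mem_cube_nat (x : E n) : ∃ j : ℕ, x ∈ cube (0 : E n) (j + 1) := by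
  obtain ⟨j, hj⟩ := exists_nat_ge ‖x‖
  exact ⟨j, closedBall_subset_cube _ _ (by rw [mem_closedBall_zero_iff]; linarith)⟩

/-- A weight of the class `A_∞` that vanishes on a cube vanishes almost everywhere. -/
theorem IsAInfty.weightMeasure_eq_zero (hw : IsAInfty w) {a : E n} {r : ℝ} (hr : 0 < r)
    (h0 : weightMeasure w (cube a r) = 0) : weightMeasure w = 0 := by
  obtain ⟨hm, q, hq, hA⟩ := hw
  have hm' : AEMeasurable fun y => (w y : ℝ≥0∞) := hm.coe_nnreal_ennreal
  have hbig : ∀ x s, 0 < s → cube a r ⊆ cube x s → weightMeasure w (cube x s) = 0 := by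
    intro x s hs hsub
    rw [weightMeasure_cube, lintegral_eq_zero_iff' hm'.restrict] at h0
    have h1 : ∫⁻ y in cube a r, (w y : ℝ≥0∞) ^ (1 - q / (q - 1)) = ∞ := by
      rw [lintegral_congr_ae (g := fun _ => ∞), setLIntegral_const,
        ENNReal.top_mul (volume_cube_pos a hr).ne']
      filter_upwards [h0] with y hy
      rw [hy, Pi.zero_apply, ENNReal.zero_rpow_of_neg (conjExponent_neg hq)]
    have h2 : avg x s (fun y => (w y : ℝ≥0∞) ^ (1 - q / (q - 1))) = ∞ := by
      rw [avg, top_le_iff.1 (h1.symm.le.trans (lintegral_mono_set hsub)),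
        ENNReal.top_div_of_ne_top (volume_cube_lt_top x s).ne]
    have h3 := (ApConst.le (a := x) hs).trans_lt hA
    rw [h2, ENNReal.top_rpow_of_pos (by linarith)] at h3
    have h4 : avg x s (fun y => (w y : ℝ≥0∞)) = 0 := by
      by_contra h
      rw [ENNReal.mul_top h] at h3
      exact h3.false
    rw [avg, ENNReal.div_eq_zero_iff, or_iff_left (volume_cube_lt_top x s).ne] at h4
    rw [weightMeasure_cube, h4]
  rw [← Measure.measure_univ_eq_zero]
  refine measure_mono_null (t := ⋃ j : ℕ, cube (0 : E n) (j + 1)) (fun x _ => ?_)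
    (measure_iUnion_null fun j => ?_)
  · exact Set.mem_iUnion.2 (exists_mem_cube_nat x)
  · obtain ⟨s, hs, hsub⟩ := exists_cube_superset a r 0
    have hj : (0 : ℝ) ≤ j := j.cast_nonneg
    refine measure_mono_null (t := cube 0 (s + j + 1)) (fun y hy i => (hy i).trans (by linarith))
      (hbig 0 (s + j + 1) (by linarith) (hsub.trans fun y hy i => (hy i).trans (by linarith)))

/-- Wilson's condition; division by `w(Q)` is meaningful because `0 < w(Q) < ∞`. -/
theorem lintegral_maximal_le (hw : IsAInfty w) {a : E n} {r : ℝ} (hr : 0 < r)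
    (hne : weightMeasure w (cube a r) ≠ 0) :
    ∫⁻ x in cube a r, maximal ((cube a r).indicator fun y => (w y : ℝ≥0∞)) x ≤
      AInftyConst w * weightMeasure w (cube a r) :=
  (ENNReal.div_le_iff hne (hw.weightMeasure_cube_lt_top a r hr).ne).1
    (le_iSup_of_le a (le_iSup_of_le r (le_iSup_of_le hr le_rfl)))

theorem one_le_aInftyConst (hw : IsAInfty w) (hne : weightMeasure w (cube (0 : E n) 1) ≠ 0) :
    1 ≤ AInftyConst w := by
  have hfin := (hw.weightMeasure_cube_lt_top 0 1 one_pos).ne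
  refine (ENNReal.mul_le_mul_iff_left hne hfin).1
    (le_trans ?_ (lintegral_maximal_le hw one_pos hne))
  have hm := (isClosed_cube (0 : E n) 1).measurableSet
  calc 1 * weightMeasure w (cube (0 : E n) 1) =
        avg 0 1 ((cube (0 : E n) 1).indicator fun y => (w y : ℝ≥0∞)) * volume (cube (0 : E n) 1) := by
        rw [avg, ENNReal.div_mul_cancel (volume_cube_pos 0 one_pos).ne' (volume_cube_lt_top _ _).ne,
          setLIntegral_indicator hm, Set.inter_self, weightMeasure_cube, one_mul]
    _ = ∫⁻ x in cube (0 : E n) 1,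
          avg 0 1 ((cube (0 : E n) 1).indicator fun y => (w y : ℝ≥0∞)) := by
        rw [setLIntegral_const]
    _ ≤ _ := setLIntegral_mono' hm fun x hx => avg_le_maximal one_pos hx

theorem weightMeasure_dya (w : E n → ℝ≥0) {a : E n} {l : ℝ} (hl : 0 < l) (k : ℕ)
    (m : Fin n → ℤ) :
    weightMeasure w (dya a l k m) = weightMeasure w (cube (ctr a l k m) (l / 2 ^ (k + 1))) :=
  measure_congr ((withDensity_absolutelyContinuous volume _).ae_eq (dya_ae_eq_cube hl))

theorem dya_anti {a : E n} {l : ℝ} {j k : ℕ} (hjk : j ≤ k) (x : E n) :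
    dya a l k (idx a l k x) ⊆ dya a l j (idx a l j x) := fun _ hy =>
  idx_eq_of_le hjk (show idx a l k _ = idx a l k x from hy)

/-- Wilson's condition on the cubes of a dyadic lattice. -/
theorem lintegral_dyadic_maximal_le (hw : IsAInfty w)
    (hne : ∀ (a : E n) (r : ℝ), 0 < r → weightMeasure w (cube a r) ≠ 0) {a : E n} {l : ℝ}
    (hl : 0 < l) (j : ℕ) (m : Fin n → ℤ) :
    ∫⁻ x in dya a l j m, (⨆ (k) (_ : j ≤ k), weightMeasure w (dya a l k (idx a l k x)) /
      volume (dya a l k (idx a l k x))) ≤ AInftyConst w * weightMeasure w (dya a l j m) := by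
  set Q := cube (ctr a l j m) (l / 2 ^ (j + 1)) with hQ
  have hr : ∀ k : ℕ, 0 < l / 2 ^ (k + 1) := fun k => by positivity
  calc _ ≤ ∫⁻ x in dya a l j m, maximal (Q.indicator fun y => (w y : ℝ≥0∞)) x := by
        refine setLIntegral_mono' (measurableSet_dya _ _ _ _) fun x hx => ?_
        have hx : idx a l j x = m := hx
        refine iSup₂_le fun k hk => ?_
        refine le_trans ?_ (avg_le_maximal (hr k) (dya_subset_cube hl (mem_dya_idx a l k x)))
        rw [avg, volume_dya hl]
        refine ENNReal.div_le_div_right ?_ _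
        rw [weightMeasure, withDensity_apply _ (measurableSet_dya _ _ _ _)]
        have hsub : dya a l k (idx a l k x) ⊆ Q := by
          have h1 := dya_anti (a := a) (l := l) hk x
          rw [hx] at h1
          exact h1.trans (dya_subset_cube hl)
        calc _ = ∫⁻ y in dya a l k (idx a l k x), Q.indicator (fun y => (w y : ℝ≥0∞)) y :=
              setLIntegral_congr_fun (measurableSet_dya _ _ _ _) fun y hy => by
                rw [Set.indicator_of_mem (hsub hy)]
          _ ≤ _ := lintegral_mono_set (dya_subset_cube hl)
    _ ≤ ∫⁻ x in Q, maximal (Q.indicator fun y => (w y : ℝ≥0∞)) x :=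
        lintegral_mono_set (dya_subset_cube hl)
    _ ≤ _ := by
        rw [weightMeasure_dya w hl]
        exact lintegral_maximal_le hw (hr j) (hne _ _ (hr j))

end

/-! ### The local inequality -/

section

variable {𝕜 : Type*} [RCLike 𝕜] {n : ℕ}

/-- Almost every point is a point of approximate continuity along the dyadic cubes. -/
theorem ae_eventually_half_lt (hn : 1 ≤ n) (g : E n → 𝕜) {a : E n} {l : ℝ} (hl : 0 < l) :
    ∀ᵐ x, ∀ t : ℝ, 0 < t → ∀ᶠ N in atTop,
      volume (cube (ctr a l N (idx a l N x)) (l / 2 ^ (N + 1))) / 2 <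
        volume ({y | ‖g y - g x‖ < t} ∩ cube (ctr a l N (idx a l N x)) (l / 2 ^ (N + 1))) := by
  obtain ⟨v, hv⟩ := exists_vitaliFamily_dyadic hn
  obtain ⟨s, hs, hsd⟩ := TopologicalSpace.exists_countable_dense 𝕜
  have h : ∀ᵐ x, ∀ q ∈ s, ∀ j : ℕ, x ∈ g ⁻¹' Metric.ball q (1 / (j + 1)) →
      Tendsto (fun b => volume (g ⁻¹' Metric.ball q (1 / (j + 1)) ∩ b) / volume b)
        (v.filterAt x) (𝓝 1) := by
    rw [ae_ball_iff hs]
    intro q _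
    rw [ae_all_iff]
    exact fun j => ae_imp_of_ae_restrict (v.ae_tendsto_measure_inter_div _)
  filter_upwards [h] with x hx t ht
  obtain ⟨j, hj⟩ := exists_nat_one_div_lt (half_pos ht)
  obtain ⟨q, hq, hqx⟩ := hsd.exists_dist_lt (g x) (show (0 : ℝ) < 1 / (j + 1) by positivity)
  have h1 := (hx q hq j hqx).comp (hv a l hl x)
  have hhalf : (1 / 2 : ℝ≥0∞) < 1 := by
    rw [one_div]; exact ENNReal.one_half_lt_one
  filter_upwards [h1.eventually_const_lt hhalf] with N hN
  have hpos : 0 < l / 2 ^ (N + 1) := by positivity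
  simp only [Function.comp] at hN
  rw [ENNReal.lt_div_iff_mul_lt (Or.inl (volume_cube_pos _ hpos).ne')
    (Or.inl (volume_cube_lt_top _ _).ne), mul_comm, mul_one_div] at hN
  refine hN.trans_le (measure_mono (Set.inter_subset_inter_left _ fun y hy => ?_))
  have hy : dist (g y) q < 1 / (j + 1) := hy
  have h2 : dist (g y) (g x) ≤ dist (g y) q + dist (g x) q := dist_triangle_right _ _ _
  change ‖g y - g x‖ < t
  rw [← dist_eq_norm]
  linarith

/-- If `f` is not zero, then every cube is contained in a cube with positive average of `|f|`; hence
the maximal function is bounded below on every cube. -/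
theorem avg_pos_of_not_ae_zero {f : E n → 𝕜} (hf : LocallyIntegrable f volume)
    (hf0 : ¬ f =ᵐ[volume] 0) (a : E n) (r : ℝ) : ∃ b s, 0 < s ∧ cube a r ⊆ cube b s ∧
      0 < avg b s (fun y => ‖f y‖ₑ) := by
  obtain ⟨j, hj⟩ : ∃ j : ℕ, ∫⁻ y in cube (0 : E n) (j + 1), ‖f y‖ₑ ≠ 0 := by
    by_contra! h
    refine hf0 ?_
    have h1 : ∀ j : ℕ, ∀ᵐ y, y ∈ cube (0 : E n) (j + 1) → f y = 0 := fun j => by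
      have h2 := h j
      rw [lintegral_eq_zero_iff' hf.aestronglyMeasurable.enorm.restrict,
        EventuallyEq, ae_restrict_iff' (isClosed_cube _ _).measurableSet] at h2
      filter_upwards [h2] with y hy hyc
      simpa using hy hyc
    filter_upwards [ae_all_iff.2 h1] with y hy
    obtain ⟨j, hj⟩ := exists_mem_cube_nat y
    exact hy j hj
  obtain ⟨s, hs, hsub⟩ := exists_cube_superset a r 0
  have hj0 : (0 : ℝ) ≤ j := j.cast_nonneg
  refine ⟨0, s + (j + 1), by positivity, hsub.trans fun y hy i => (hy i).trans (by linarith), ?_⟩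
  refine ENNReal.div_pos ?_ (volume_cube_lt_top _ _).ne
  refine fun h => hj (le_antisymm (le_trans (lintegral_mono_set ?_) h.le) zero_le)
  exact fun y hy i => (hy i).trans (by linarith)

/-- The local form of the inequality, on a large cube around the origin. -/
theorem KernelData.lintegral_dya_rpow_le {T : L2 𝕜 n →L[𝕜] L2 𝕜 n} (D : KernelData T)
    (hn : 1 ≤ n) : ∃ C : ℝ≥0, 0 < C ∧ ∀ w : E n → ℝ≥0, IsAInfty w →
    (∀ (a : E n) (r : ℝ), 0 < r → weightMeasure w (cube a r) ≠ 0) → ∀ p : ℝ, 0 < p →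
    ∀ (f g : E n → 𝕜) (hf : LocallyIntegrable f volume), HasValue T hf g → ¬ f =ᵐ[volume] 0 →
    ∫⁻ x, maximal (fun y => ‖f y‖ₑ) x ^ p ∂(weightMeasure w) ≠ ∞ → ∀ (a : E n) (l : ℝ), 0 < l →
    ∀ t : ℝ, 0 < t → volume {x | t < ‖g x‖} ≤ volume (dya a l 0 0) / 4 →
    ∫⁻ x in dya a l 0 0, (‖g x‖ₑ - ENNReal.ofReal (2 * t)) ^ p ∂(weightMeasure w) ≤
      (C * ENNReal.ofReal (max 1 p) * (2 * AInftyConst w + 1)) ^ p *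
        ∫⁻ x, maximal (fun y => ‖f y‖ₑ) x ^ p ∂(weightMeasure w) := by
  -- small enough for the exceptional sets of a cube and of its parent not to cover the cube
  set η : ℝ≥0∞ := (4 * 2 ^ n)⁻¹ with hη
  have hη4 : η ≤ 4⁻¹ := ENNReal.inv_le_inv.2
    (le_mul_of_one_le_right zero_le (one_le_pow₀ one_le_two))
  have hη2 : η * 2 ^ n = 4⁻¹ := by
    rw [hη, ENNReal.mul_inv (Or.inl (by simp)) (Or.inl (by simp)), mul_assoc,
      ENNReal.inv_mul_cancel (by simp) (by simp), mul_one]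
  obtain ⟨C, hC0, hC⟩ := D.exists_const_near hn (η := η)
    (ENNReal.inv_pos.2 (by finiteness)) (ENNReal.inv_ne_top.2 (by simp))
  refine ⟨5 * C, by positivity, fun w hw hne p hp f g hf hg hf0 hY a l hl t ht hvol => ?_⟩
  set μ := weightMeasure w with hμ
  set Mf := maximal (fun y => ‖f y‖ₑ) with hMf
  have hr : ∀ k : ℕ, 0 < l / 2 ^ (k + 1) := fun k => by positivity
  let Q : ℕ → (Fin n → ℤ) → Set (E n) := fun k m => cube (ctr a l k m) (l / 2 ^ (k + 1))
  have hQ : ∀ k m, dya a l k m ⊆ Q k m := fun k m => dya_subset_cube hl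
  -- the infimum of the maximal function over a dyadic cube
  let I : ℕ → (Fin n → ℤ) → ℝ≥0∞ := fun k m => ⨅ x ∈ dya a l k m, Mf x
  have hIavg : ∀ k m (a' : E n) (r' : ℝ), 0 < r' → Q k m ⊆ cube a' r' →
      avg a' r' (fun y => ‖f y‖ₑ) ≤ I k m := fun k m a' r' hr' hsub =>
    le_iInf₂ fun x hx => avg_le_maximal hr' (hsub (hQ k m hx))
  have hI0 : ∀ k m, I k m ≠ 0 := fun k m => by
    obtain ⟨b, s, hs, hsub, hpos⟩ := avg_pos_of_not_ae_zero hf hf0 (ctr a l k m) (l / 2 ^ (k + 1))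
    exact (hpos.trans_le (hIavg k m b s hs hsub)).ne'
  have hItop : ∀ k m, I k m ≠ ∞ := fun k m htop => by
    refine hY (top_le_iff.1 ?_)
    calc ∞ = ∫⁻ x in dya a l k m, ∞ ∂μ := by
          rw [setLIntegral_const, ENNReal.top_mul]
          rw [hμ, weightMeasure_dya w hl]
          exact hne _ _ (hr k)
      _ ≤ ∫⁻ x in dya a l k m, Mf x ^ p ∂μ := by
          refine setLIntegral_mono' (measurableSet_dya _ _ _ _) fun x hx => ?_
          have : Mf x = ∞ := top_le_iff.1 (htop.symm.le.trans (iInf₂_le x hx))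
          rw [this, ENNReal.top_rpow_of_pos hp]
      _ ≤ _ := setLIntegral_le_lintegral _ _
  have hI : ∀ k m, (((I k m).toNNReal : ℝ≥0) : ℝ≥0∞) = I k m := fun k m =>
    ENNReal.coe_toNNReal (hItop k m)
  let A : ℕ → (Fin n → ℤ) → ℝ≥0 := fun k m => C * (I k m).toNNReal
  have hA : ∀ k m, A k (par m) ≤ A (k + 1) m := fun k m => by
    have h1 : I k (par m) ≤ I (k + 1) m := biInf_mono fun x hx => dya_subset_par hx
    exact mul_le_mul_right (ENNReal.toNNReal_mono (hItop _ _) h1) C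
  choose c hc using fun k m => hC f g hf hg (ctr a l k m) (l / 2 ^ (k + 1)) (hr k)
    (I k m).toNNReal (ENNReal.toNNReal_pos (hI0 k m) (hItop k m))
    (fun a' r' hr' hsub => by rw [hI]; exact hIavg k m a' r' hr' hsub)
  have hbad : ∀ k m, volume (Q k m ∩ {x | A k m < ‖g x - c k m‖₊}) ≤
      η * volume (dya a l k m) := fun k m => by
    rw [volume_dya hl]
    refine le_trans (measure_mono (Set.inter_subset_inter_right _ fun x hx => ?_)) (hc k m)
    have hx : A k m < ‖g x - c k m‖₊ := hx
    change (C : ℝ≥0∞) * ((I k m).toNNReal : ℝ≥0) < ‖g x - c k m‖ₑ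
    rw [enorm_eq_nnnorm]
    exact_mod_cast hx
  have hbad4 : ∀ k m, volume (Q k m ∩ {x | A k m < ‖g x - c k m‖₊}) ≤
      volume (dya a l k m) / 4 := fun k m => by
    refine (hbad k m).trans ?_
    rw [ENNReal.div_eq_inv_mul]
    gcongr
  have hE : ∀ k m, volume (idx a l k ⁻¹' {m} ∩ {x | A k m < ‖g x - c k m‖₊}) ≤
      volume (idx a l k ⁻¹' {m}) / 4 := fun k m =>
    (measure_mono (Set.inter_subset_inter_left _ (hQ k m))).trans (hbad4 k m)
  have hhalf : ∀ v : ℝ≥0∞, v ≠ 0 → v ≠ ∞ → v / 4 + v / 4 < v := fun v h0 h1 => by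
    lift v to ℝ≥0 using h1
    have h0 : 0 < v := pos_iff_ne_zero.2 (by exact_mod_cast h0)
    rw [show (4 : ℝ≥0∞) = ((4 : ℝ≥0) : ℝ≥0∞) by norm_num, ← ENNReal.coe_div (by norm_num)]
    norm_cast
    rw [← NNReal.coe_lt_coe]
    push_cast
    have : (0 : ℝ) < v := h0
    linarith
  -- a point of the smaller cube at which `g` is close to both constants
  have hstep : ∀ k m, ‖c (k + 1) m - c k (par m)‖ ≤ A (k + 1) m + A k (par m) := fun k m => by
    have h1 : volume (dya a l (k + 1) m ∩ {x | A k (par m) < ‖g x - c k (par m)‖₊}) ≤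
        volume (dya a l (k + 1) m) / 4 := by
      refine (measure_mono (Set.inter_subset_inter_left _ (dya_subset_par.trans (hQ k _)))).trans
        ((hbad k (par m)).trans (le_of_eq ?_))
      rw [volume_dya_par hl (par m) m, ← mul_assoc, hη2, ENNReal.div_eq_inv_mul]
    obtain ⟨y, hy, hy1, hy2⟩ : ∃ y ∈ dya a l (k + 1) m, ‖g y - c (k + 1) m‖₊ ≤ A (k + 1) m ∧
        ‖g y - c k (par m)‖₊ ≤ A k (par m) := by
      by_contra! h
      refine (hhalf _ (volume_dya_pos hl).ne' (volume_dya_lt_top hl).ne).not_ge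
        (le_trans ?_ (add_le_add (hE (k + 1) m) h1))
      refine (measure_mono fun y hy => ?_).trans (measure_union_le _ _)
      by_cases h2 : ‖g y - c (k + 1) m‖₊ ≤ A (k + 1) m
      · exact Or.inr ⟨hy, h y hy h2⟩
      · exact Or.inl ⟨hy, not_le.1 h2⟩
    have hy1 : ‖g y - c (k + 1) m‖ ≤ A (k + 1) m := hy1
    have hy2 : ‖g y - c k (par m)‖ ≤ A k (par m) := hy2
    have h2 := norm_sub_le_norm_sub_add_norm_sub (c (k + 1) m) (g y) (c k (par m))
    rw [norm_sub_rev (c (k + 1) m) (g y)] at h2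
    linarith
  have hroot : ‖c 0 0‖ ≤ t + A 0 0 := by
    obtain ⟨y, hy, hy1, hy2⟩ : ∃ y ∈ dya a l 0 0, ‖g y - c 0 0‖₊ ≤ A 0 0 ∧ ‖g y‖ ≤ t := by
      by_contra! h
      refine (hhalf _ (volume_dya_pos hl).ne' (volume_dya_lt_top hl).ne).not_ge
        (le_trans ?_ (add_le_add (hE 0 0) hvol))
      refine (measure_mono fun y hy => ?_).trans (measure_union_le _ _)
      by_cases h2 : ‖g y - c 0 0‖₊ ≤ A 0 0
      · exact Or.inr (h y hy h2)
      · exact Or.inl ⟨hy, not_le.1 h2⟩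
    have hy1 : ‖g y - c 0 0‖ ≤ A 0 0 := hy1
    have h2 := norm_le_norm_add_norm_sub' (c 0 0) (g y)
    rw [norm_sub_rev] at h2
    linarith
  let V : ℕ → (Fin n → ℤ) → ℝ≥0 := fun k m => stopSum par c A k m + A k m
  have hpt : ∀ᵐ x, x ∈ dya a l 0 0 → ∀ᶠ N in atTop,
      ‖g x‖ₑ - ENNReal.ofReal (2 * t) ≤ 5 * V N (idx a l N x) := by
    filter_upwards [ae_eventually_half_lt hn g (a := a) hl] with x hx hx0
    have hx0 : idx a l 0 x = 0 := hx0
    filter_upwards [hx t ht] with N hN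
    set m := idx a l N x with hm
    obtain ⟨y, hy1, hy2⟩ : ∃ y, ‖g y - g x‖ < t ∧ ‖g y - c N m‖₊ ≤ A N m := by
      by_contra! h
      refine hN.not_ge (le_trans (measure_mono fun y hy => ?_)
        ((hbad4 N m).trans ?_))
      · exact ⟨hy.2, h y hy.1⟩
      · rw [volume_dya hl]
        exact ENNReal.div_le_div_left (by norm_num) _
    have hy2 : ‖g y - c N m‖ ≤ A N m := hy2
    have h1 := norm_sub_root_le (π := par) hA hstep N m
    rw [root_idx (fun k x => par_idx a l k x) N x, hx0] at h1
    have h2 : (A 0 0 : ℝ) ≤ stopSum par c A N m := by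
      have := A_zero_le_stopSum (π := par) (c := c) (A := A) N m
      rw [root_idx (fun k x => par_idx a l k x) N x, hx0] at this
      exact_mod_cast this
    have h3 : ‖g x‖ ≤ ‖g y - g x‖ + ‖g y - c N m‖ + ‖c N m - c 0 0‖ + ‖c 0 0‖ := by
      calc ‖g x‖ = ‖-(g y - g x) + (g y - c N m) + (c N m - c 0 0) + c 0 0‖ := by congr 1; ring
        _ ≤ _ := by
          refine (norm_add_le _ _).trans (add_le_add_left ((norm_add_le _ _).trans
            (add_le_add_left ((norm_add_le _ _).trans ?_) _)) _)
          rw [norm_neg]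
    have h4 : ‖g x‖ ≤ 5 * (V N m : ℝ) + 2 * t := by
      have : (V N m : ℝ) = stopSum par c A N m + A N m := NNReal.coe_add _ _
      have : (0 : ℝ) ≤ A N m := (A N m).2
      linarith
    rw [tsub_le_iff_right, ← ofReal_norm]
    refine (ENNReal.ofReal_le_ofReal h4).trans ?_
    rw [ENNReal.ofReal_add (by positivity) (by positivity), ENNReal.ofReal_mul (by norm_num),
      ENNReal.ofReal_coe_nnreal]
    norm_num
  have hVm : ∀ N, Measurable fun x => (5 * (V N (idx a l N x) : ℝ≥0∞)) ^ p := fun N =>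
    (measurable_of_countable fun m => (5 * (V N m : ℝ≥0∞)) ^ p).comp (measurable_idx a l N)
  have hbound : ∀ N, ∫⁻ x, (5 * (V N (idx a l N x) : ℝ≥0∞)) ^ p ∂μ ≤
      ((5 * C : ℝ≥0) * ENNReal.ofReal (max 1 p) * (2 * AInftyConst w + 1)) ^ p *
        ∫⁻ x, Mf x ^ p ∂μ := fun N => by
    have h1 := lintegral_stopSum_rpow_le (fun k x => par_idx a l k x) (measurable_idx a l)
      (fun k m => volume_dya_lt_top hl) (fun k m => (volume_dya_pos hl).ne') hE
      (fun j m => lintegral_dyadic_maximal_le hw hne hl j m) hA hp N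
    have h2 : ∫⁻ x, (A N (idx a l N x) : ℝ≥0∞) ^ p ∂μ ≤ (C : ℝ≥0∞) ^ p * ∫⁻ x, Mf x ^ p ∂μ := by
      rw [← lintegral_const_mul' _ _ (by finiteness)]
      refine lintegral_mono fun x => ?_
      rw [← ENNReal.mul_rpow_of_nonneg _ _ hp.le]
      refine ENNReal.rpow_le_rpow ?_ hp.le
      rw [ENNReal.coe_mul, hI]
      gcongr
      exact iInf₂_le x (mem_dya_idx a l N x)
    simp_rw [ENNReal.mul_rpow_of_nonneg _ _ hp.le] at h1 ⊢
    rw [lintegral_const_mul' _ _ (by finiteness)]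
    calc _ ≤ 5 ^ p * (ENNReal.ofReal (max 1 p) ^ p * (2 * AInftyConst w + 1) ^ p *
          ((C : ℝ≥0∞) ^ p * ∫⁻ x, Mf x ^ p ∂μ)) := by
          gcongr
          exact h1.trans (mul_le_mul_right h2 _)
      _ = _ := by
          rw [ENNReal.coe_mul, ENNReal.mul_rpow_of_nonneg _ _ hp.le]
          push_cast
          ring
  have hac : μ ≪ volume := withDensity_absolutelyContinuous volume _
  calc _ ≤ ∫⁻ x in dya a l 0 0,
          liminf (fun N => (5 * (V N (idx a l N x) : ℝ≥0∞)) ^ p) atTop ∂μ := by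
        refine setLIntegral_mono_ae' (measurableSet_dya _ _ _ _) ?_
        filter_upwards [hac.ae_le hpt] with x hx hx0
        refine le_liminf_of_le (by isBoundedDefault) ?_
        filter_upwards [hx hx0] with N hN
        exact ENNReal.rpow_le_rpow hN hp.le
    _ ≤ ∫⁻ x, liminf (fun N => (5 * (V N (idx a l N x) : ℝ≥0∞)) ^ p) atTop ∂μ :=
        setLIntegral_le_lintegral _ _
    _ ≤ liminf (fun N => ∫⁻ x, (5 * (V N (idx a l N x) : ℝ≥0∞)) ^ p ∂μ) atTop :=
        lintegral_liminf_le hVm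
    _ ≤ _ := liminf_le_of_le (by isBoundedDefault) fun b hb => by
        obtain ⟨N, hN⟩ := hb.exists
        exact hN.trans (hbound N)

end

/-! ### Globalization -/

section

variable {𝕜 : Type*} [RCLike 𝕜] {n : ℕ}

theorem HasValue.ae_eq_zero {T : L2 𝕜 n →L[𝕜] L2 𝕜 n} {f g : E n → 𝕜}
    {hf : LocallyIntegrable f volume} (hg : HasValue T hf g) (hf0 : f =ᵐ[volume] 0) :
    g =ᵐ[volume] 0 := by
  have hT : ∀ k : ℕ, T ((memLp_trunc hf k).toLp (trunc f k)) =ᵐ[volume] (0 : E n → 𝕜) := fun k => by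
    have h1 : trunc f k =ᵐ[volume] 0 := by
      filter_upwards [hf0] with x hx
      have := enorm_trunc_le f k x
      rw [hx] at this
      simpa using this
    have h2 : (memLp_trunc hf k).toLp (trunc f k) = 0 :=
      (Lp.eq_zero_iff_ae_eq_zero).2 ((memLp_trunc hf k).coeFn_toLp.trans h1)
    rw [h2, map_zero]
    exact Lp.coeFn_zero _ _ _
  have hball : ∀ R : ℕ, ∀ᵐ x, x ∈ Metric.ball (0 : E n) R → g x = 0 := fun R => by
    rw [← ae_restrict_iff' Metric.isOpen_ball.measurableSet]
    refine tendstoInMeasure_ae_unique ((hg.2 R).congr_left fun k => ae_restrict_of_ae (hT k)) ?_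
    intro ε hε
    refine tendsto_const_nhds.congr fun k => ?_
    simp [hε.ne']
  filter_upwards [ae_all_iff.2 hball] with x hx
  obtain ⟨R, hR⟩ := exists_nat_gt ‖x‖
  exact hx R (mem_ball_zero_iff.2 hR)

/-- A bound for `g` minus a level on large cubes around the origin passes to `g` by Fatou's lemma,
when the level tends to zero and the cubes exhaust the space. -/
theorem lintegral_rpow_le_of_dyadic {μ : Measure (E n)} {g : E n → 𝕜}
    (hn : 1 ≤ n) (hgm : AEStronglyMeasurable g μ)
    (hfin : ∀ t : ℝ, 0 < t → volume {x | t < ‖g x‖} < ∞) {p : ℝ} {K : ℝ≥0∞}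
    (h : ∀ (a : E n) (l : ℝ), 0 < l → ∀ t : ℝ, 0 < t →
      volume {x | t < ‖g x‖} ≤ volume (dya a l 0 0) / 4 →
      ∫⁻ x in dya a l 0 0, (‖g x‖ₑ - ENNReal.ofReal (2 * t)) ^ p ∂μ ≤ K) :
    ∫⁻ x, ‖g x‖ₑ ^ p ∂μ ≤ K := by
  -- levels tending to zero, and cubes large compared with the corresponding level sets
  let t : ℕ → ℝ := fun i => 1 / (i + 1)
  have ht : ∀ i, 0 < t i := fun i => by positivity
  let L : ℕ → ℝ := fun i => i + 1 + 4 * (volume {x | t i < ‖g x‖}).toReal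
  have hLi : ∀ i : ℕ, (i : ℝ) + 1 ≤ L i := fun i => by
    have : 0 ≤ (volume {x | t i < ‖g x‖}).toReal := ENNReal.toReal_nonneg
    simp only [L]
    linarith
  have hL : ∀ i, 0 < L i := fun i => by have := hLi i; positivity
  let Q : ℕ → Set (E n) := fun i => dya (WithLp.toLp 2 fun _ => -L i : E n) (2 * L i) 0 0
  have hQm : ∀ i, MeasurableSet (Q i) := fun i => measurableSet_dya _ _ _ _
  have hQ : ∀ i, volume {x | t i < ‖g x‖} ≤ volume (Q i) / 4 := fun i => by
    rw [ENNReal.le_div_iff_mul_le (by simp) (by simp), volume_dya_zero (hL i),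
      ← ENNReal.ofReal_toReal (hfin (t i) (ht i)).ne]
    have h1 : ENNReal.ofReal (volume {x | t i < ‖g x‖}).toReal * 4 ≤ ENNReal.ofReal (2 * L i) := by
      rw [show (4 : ℝ≥0∞) = ENNReal.ofReal 4 by norm_num,
        ← ENNReal.ofReal_mul ENNReal.toReal_nonneg]
      refine ENNReal.ofReal_le_ofReal ?_
      have : 0 ≤ (volume {x | t i < ‖g x‖}).toReal := ENNReal.toReal_nonneg
      have : (0 : ℝ) ≤ i := i.cast_nonneg
      simp only [L]
      linarith
    refine h1.trans (le_self_pow₀ ?_ (by omega))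
    rw [← ENNReal.ofReal_one]
    refine ENNReal.ofReal_le_ofReal ?_
    have := hLi i
    have : (0 : ℝ) ≤ i := i.cast_nonneg
    linarith
  let F : ℕ → E n → ℝ≥0∞ := fun i => (Q i).indicator fun x =>
    (‖g x‖ₑ - ENNReal.ofReal (2 * t i)) ^ p
  have hFm : ∀ i, AEMeasurable (F i) μ := fun i =>
    ((hgm.enorm.sub aemeasurable_const).pow_const p).indicator (hQm i)
  have hFK : ∀ i, ∫⁻ x, F i x ∂μ ≤ K := fun i => by
    rw [lintegral_indicator (hQm i)]
    exact h _ _ (by have := hL i; positivity) (t i) (ht i) (hQ i)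
  have hlim : ∀ x, Tendsto (fun i => F i x) atTop (𝓝 (‖g x‖ₑ ^ p)) := fun x => by
    have h1 : Tendsto (fun i => ENNReal.ofReal (2 * t i)) atTop (𝓝 0) := by
      have := (tendsto_one_div_add_atTop_nhds_zero_nat (𝕜 := ℝ)).const_mul 2
      rw [mul_zero] at this
      simpa [t] using ENNReal.tendsto_ofReal this
    have h2 : Tendsto (fun i => (‖g x‖ₑ - ENNReal.ofReal (2 * t i)) ^ p) atTop
        (𝓝 (‖g x‖ₑ ^ p)) := by
      have h3 := ENNReal.Tendsto.sub (tendsto_const_nhds (x := ‖g x‖ₑ)) h1 (Or.inl enorm_ne_top)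
      rw [tsub_zero] at h3
      exact h3.ennrpow_const p
    refine h2.congr' ?_
    filter_upwards [eventually_ge_atTop ⌈‖x‖⌉₊] with i hi
    have hxi : ‖x‖ ≤ i := Nat.ceil_le.1 hi
    have hx : x ∈ Q i := (mem_dya_zero (hL i)).2 fun j => by
      have h3 := (PiLp.norm_apply_le x j).trans hxi
      rw [Real.norm_eq_abs, abs_le] at h3
      have := hLi i
      constructor <;> linarith [h3.1, h3.2]
    simp only [F, Set.indicator_of_mem hx]
  calc _ = ∫⁻ x, liminf (fun i => F i x) atTop ∂μ :=
        lintegral_congr fun x => (hlim x).liminf_eq.symm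
    _ ≤ liminf (fun i => ∫⁻ x, F i x ∂μ) atTop := lintegral_liminf_le' hFm
    _ ≤ K := liminf_le_of_le (by isBoundedDefault) fun b hb => by
        obtain ⟨i, hi⟩ := hb.exists
        exact hi.trans (hFK i)

end

end CZWeights

theorem mainTheorem1 {𝕜 : Type*} [RCLike 𝕜] {n : ℕ} (hn : 1 ≤ n)
    (T : CZWeights.L2 𝕜 n →L[𝕜] CZWeights.L2 𝕜 n) (hT : CZWeights.IsCalderonZygmund T) :
    ∃ c : ℝ≥0, ∀ w : CZWeights.E n → ℝ≥0, CZWeights.IsAInfty w →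
      ∀ p : ℝ, 0 < p →
      ∀ (f g : CZWeights.E n → 𝕜) (hf : LocallyIntegrable f volume), CZWeights.HasValue T hf g →
        (∀ t : ℝ, 0 < t → volume {x | t < ‖g x‖} < ∞) →
        eLpNorm g (ENNReal.ofReal p) (CZWeights.weightMeasure w) ≤
          c * ENNReal.ofReal (max 1 p) * CZWeights.AInftyConst w *
            eLpNorm (CZWeights.maximal fun y => ‖f y‖ₑ) (ENNReal.ofReal p)
              (CZWeights.weightMeasure w) := by
  obtain ⟨D⟩ := hT.exists_kernelData
  obtain ⟨C, hC0, hC⟩ := D.lintegral_dya_rpow_le hn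
  refine ⟨3 * C, fun w hw p hp f g hf hg hfin => ?_⟩
  have hac : CZWeights.weightMeasure w ≪ volume := withDensity_absolutelyContinuous volume _
  by_cases hf0 : f =ᵐ[volume] 0
  · rw [eLpNorm_congr_ae (hac.ae_eq (hg.ae_eq_zero hf0)), eLpNorm_zero]
    exact zero_le
  -- otherwise `w` is positive on every cube, which makes the quotients in Wilson's constant genuine
  by_cases hw0 : CZWeights.weightMeasure w = 0
  · simp [hw0]
  have hne : ∀ (a : CZWeights.E n) (r : ℝ), 0 < r →
      CZWeights.weightMeasure w (CZWeights.cube a r) ≠ 0 :=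
    fun a r hr h => hw0 (hw.weightMeasure_eq_zero hr h)
  have hw1 := CZWeights.one_le_aInftyConst hw (hne 0 1 one_pos)
  have hp0 : ENNReal.ofReal p ≠ 0 := by simpa using hp
  rw [eLpNorm_eq_lintegral_rpow_enorm_toReal hp0 ENNReal.ofReal_ne_top,
    eLpNorm_eq_lintegral_rpow_enorm_toReal hp0 ENNReal.ofReal_ne_top, ENNReal.toReal_ofReal hp.le]
  simp only [enorm_eq_self]
  set K := (C : ℝ≥0∞) * ENNReal.ofReal (max 1 p) * (2 * CZWeights.AInftyConst w + 1) with hK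
  set Y := ∫⁻ x, CZWeights.maximal (fun y => ‖f y‖ₑ) x ^ p ∂(CZWeights.weightMeasure w) with hY
  have hKle : K ≤ (3 * C : ℝ≥0) * ENNReal.ofReal (max 1 p) * CZWeights.AInftyConst w := by
    calc K ≤ (C : ℝ≥0∞) * ENNReal.ofReal (max 1 p) *
          (2 * CZWeights.AInftyConst w + CZWeights.AInftyConst w) := by
          rw [hK]; gcongr
      _ = _ := by push_cast; ring
  refine le_trans ?_ (mul_le_mul_left hKle _)
  have hK0 : K ≠ 0 := by
    refine mul_ne_zero (mul_ne_zero (by exact_mod_cast hC0.ne') ?_) (by simp)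
    exact (ENNReal.ofReal_pos.2 (lt_max_of_lt_left one_pos)).ne'
  by_cases hYtop : Y = ∞
  · rw [hYtop, ENNReal.top_rpow_of_pos (by positivity), ENNReal.mul_top hK0]
    exact le_top
  have hmain : ∫⁻ x, ‖g x‖ₑ ^ p ∂(CZWeights.weightMeasure w) ≤ K ^ p * Y :=
    CZWeights.lintegral_rpow_le_of_dyadic hn (hg.1.mono_ac hac) hfin fun a l hl t ht hvol =>
      hC w hw hne p hp f g hf hg hf0 hYtop a l hl t ht hvol
  refine (ENNReal.rpow_le_rpow hmain (by positivity)).trans (le_of_eq ?_)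
  rw [ENNReal.mul_rpow_of_nonneg _ _ (by positivity), ← ENNReal.rpow_mul,
    mul_one_div_cancel hp.ne', ENNReal.rpow_one]
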